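/- A coloring of a graph has clustering $\eta$ if every connected component of the subgraph induced by a color class has at most $\eta$ vertices; a graph is $3$-colorable with clustering $\eta$ if it has such a coloring with $3$ colors. The layered treewidth of a graph $G$ is the minimum integer $\ell\ge 0$ for which $G$ has a tree-decomposition $(X_x : x\in V(T))$ and a layering $(V_1,\dots,V_n)$ (an ordered partition of $V(G)$ into possibly empty sets such that the ends of each edge lie in $V_i\cup V_{i+1}$ for some $i$) with $|X_x\cap V_i|\le \ell$ for each bag $X_x$ and each layer $V_i$. The Euler genus of a graph $G$ is the minimum Euler genus of a surface in which $G$ embeds without crossings, where the Euler genus of a closed connected surface of Euler characteristic $\chi$ is $2-\chi$ (that is, $2h$ for the orientable surface with $h$ handles and $c$ for the non-orientable surface with $c$ cross-caps). (1) There is an absolute constant $C$ such that for all integers $w\ge 1$ and $\Delta\ge 1$, every finite simple graph with layered treewidth at most $w$ and maximum degree at most $\Delta$ is $3$-colorable with clustering $C\,w^{19}\Delta^{37}$. (2) There is an absolute constant $C$ such that for all integers $g\ge 1$ and $\Delta\ge 1$, every finite simple graph with Euler genus at most $g$ and maximum degree at most $\Delta$ is $3$-colorable with clustering $C\,g^{19}\Delta^{37}$.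 -/

import Mathlib

universe u

/-! ### Tree-decompositions, layerings, layered treewidth -/

/-- A tree-decomposition of `G` indexed by the nodes of the tree `T`. -/
structure TreeDecomposition {V : Type u} (G : SimpleGraph V) {ι : Type} (T : SimpleGraph ι) where
  isTree : T.IsTree
  /-- The bag at each node. -/
  bag : ι → Set V
  bag_nonempty : ∀ x, (bag x).Nonempty
  /-- The nodes whose bag contains `v` induce a non-empty connected subtree
  (`Connected` includes non-emptiness). -/
  subtree : ∀ v : V, (T.induce {x | v ∈ bag x}).Connected
  edge_mem : ∀ v w : V, G.Adj v w → ∃ x, v ∈ bag x ∧ w ∈ bag x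

/-- A layering of `G`: an ordered partition `(V_0, V_1, …)` of the vertex set into possibly empty
sets, given by the function sending a vertex to the index of its layer, such that the ends of each
edge lie in `V_i ∪ V_{i+1}` for some `i`. (For finite `V` only finitely many layers are
non-empty.) -/
structure Layering {V : Type u} (G : SimpleGraph V) where
  /-- The index of the layer of a vertex. -/
  index : V → ℕ
  adj : ∀ v w : V, G.Adj v w →
    ∃ i, (index v = i ∨ index v = i + 1) ∧ (index w = i ∨ index w = i + 1)

/-- The `i`-th layer. -/
def Layering.layer {V : Type u} {G : SimpleGraph V} (L : Layering G) (i : ℕ) : Set V :=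
  {v | L.index v = i}

/-- `G` has a tree-decomposition (over a finite tree) and a layering such that each bag meets each
layer in at most `l` vertices. -/
def HasLayeredTreeDecomposition {V : Type u} (G : SimpleGraph V) (l : ℕ) : Prop :=
  ∃ (ι : Type) (_ : Finite ι) (T : SimpleGraph ι) (D : TreeDecomposition G T) (L : Layering G),
    ∀ (x : ι) (i : ℕ), (D.bag x ∩ L.layer i).encard ≤ l

/-- The layered treewidth of a finite graph. (The set is non-empty as soon as `V` is finite and
non-empty, since a single bag may be used; the value is `0` for the graph without vertices.) -/
noncomputable def layeredTreewidth {V : Type u} (G : SimpleGraph V) : ℕ :=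
  sInf {l : ℕ | HasLayeredTreeDecomposition G l}

/-! ### Clustered colorings -/

/-- The coloring `c` of `G` has clustering `η`: for each color `i`, every connected component of
the subgraph induced by the vertices of color `i` has at most `η` vertices. -/
def HasClustering {V : Type u} (G : SimpleGraph V) {k : ℕ} (c : V → Fin k) (η : ℕ) : Prop :=
  ∀ (i : Fin k) (K : (G.induce {v | c v = i}).ConnectedComponent), K.supp.encard ≤ η

/-- `G` is `k`-colorable with clustering `η`. -/
def ColorableWithClustering {V : Type u} (G : SimpleGraph V) (k η : ℕ) : Prop :=
  ∃ c : V → Fin k, HasClustering G c η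

/-! ### Surfaces and Euler genus -/

/-- A closed connected surface with a finite cell decomposition, orientable or not, given by its
flags. A flag is a triangle of the barycentric subdivision, with one corner on a vertex, one on an
edge and one on a face of the decomposition (dimensions `0`, `1`, `2`); `swap i a` is the other
triangle on the side of `a` opposite to its corner of dimension `i`. There is always such another
triangle, because the surface has no boundary, and each edge is surrounded by exactly four flags
`a`, `swap 0 a`, `swap 2 a`, `swap 0 (swap 2 a) = swap 2 (swap 0 a)`. Conversely, gluing triangles
according to such data gives a closed connected surface with a cell decomposition. -/
structure CellularSurface (Φ : Type) where
  nonempty : Nonempty Φ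
  finite : Finite Φ
  /-- The three adjacencies of flags. -/
  swap : Fin 3 → Φ → Φ
  swap_swap : ∀ i a, swap i (swap i a) = a
  swap_ne : ∀ i a, swap i a ≠ a
  swap_comm : ∀ a, swap 0 (swap 2 a) = swap 2 (swap 0 a)
  swap_swap_ne : ∀ a, swap 0 (swap 2 a) ≠ a
  connected : ∀ a b : Φ, Relation.ReflTransGen (fun x y => ∃ i, y = swap i x) a b

namespace CellularSurface

variable {Φ : Type} (M : CellularSurface Φ)

/-- The cells of dimension `k` (vertices, edges, faces for `k = 0, 1, 2`): classes of flags under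
the adjacencies that keep the corner of dimension `k`. -/
def Cell (k : Fin 3) : Type :=
  Quot (fun a b : Φ => ∃ i, i ≠ k ∧ b = M.swap i a)

/-- The cell of dimension `k` of a flag. -/
def cell (k : Fin 3) (a : Φ) : M.Cell k :=
  Quot.mk _ a

/-- Vertices minus edges plus faces. -/
noncomputable def eulerChar : ℤ :=
  (Nat.card (M.Cell 0) : ℤ) - Nat.card (M.Cell 1) + Nat.card (M.Cell 2)

/-- The Euler genus of the surface: `2 - χ`, that is `2h` for the orientable surface with `h`
handles and `c` for the non-orientable surface with `c` cross-caps. -/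
noncomputable def eulerGenus : ℤ :=
  2 - M.eulerChar

/-- The 1-skeleton without its loops and with parallel edges identified: two distinct vertices are
adjacent if some edge of the decomposition joins them. -/
def skeleton : SimpleGraph (M.Cell 0) where
  Adj x y := x ≠ y ∧ ∃ a : Φ, M.cell 0 a = x ∧ M.cell 0 (M.swap 0 a) = y
  symm := by
    constructor
    rintro x y ⟨h, a, ha, hb⟩
    exact ⟨h.symm, M.swap 0 a, hb, by rw [M.swap_swap]; exact ha⟩
  loopless := by
    constructor
    intro x h
    exact h.1 rfl

end CellularSurface

/-- `G` embeds without crossings in a surface of Euler genus `n`: for some cell decomposition of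
such a surface, `G` is (isomorphic to) a subgraph of the 1-skeleton. The embedding of `G` itself
need not be cellular, and `G` need not be connected. -/
def EmbedsInEulerGenus {V : Type u} (G : SimpleGraph V) (n : ℕ) : Prop :=
  ∃ (Φ : Type) (M : CellularSurface Φ), M.eulerGenus = n ∧ G.IsContained M.skeleton

/-- The Euler genus of a graph: the minimum Euler genus of a surface in which it embeds (`⊤` if
there is none, which does not happen for finite graphs). -/
noncomputable def graphEulerGenus {V : Type u} (G : SimpleGraph V) : ℕ∞ :=
  ⨅ (n : ℕ) (_ : EmbedsInEulerGenus G n), (n : ℕ∞)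

/-! Both parts rest on one coloring argument for graphs with a layered tree-decomposition, which
gives clustering of order `w ^ 10 * Δ ^ 31`; embedded graphs are reduced to it by constructing such
a decomposition of width `8 * g + 16`.

Coloring. Layers whose index is 0, 1, 2 mod 3 use the color pairs {0, 1}, {1, 2}, {2, 0}. Each color
then misses one residue, so its components lie in two consecutive layers. Layers of residue 0 are
2-colored freely, then residue 1, then residue 2, each time without chaining together the components
already present in the adjacent layers. This is `exists_coloring_extending`: if `W` induces small
components, each of them is replaced by a clique on its neighbours in the new layer `X`. The
resulting graph `throughGraph` on `X` still has bounded treewidth and degree, so it has a 2-coloring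
with small monochromatic components, and restoring the components of `W` enlarges these by a bounded
factor only.

The 2-coloring is `exists_coloring_of_hasSeparations_aux`, an induction with a prescribed
monochromatic set `S`: a large `S` is split by a balanced separation, a small one is peeled off by
giving all its neighbours the other color.

Genus. In the radial graph (vertices against faces) take a breadth-first spanning tree. The dual of
its complement, whose nodes are the edges of the surface, is connected; take a spanning tree `T` of
it. By Euler's formula at most `2 * g` flags belong to neither tree. The bag at an edge consists of
the vertices that are ancestors of corners of its flags or of the exceptional flags. A corner has at
most one ancestor at each depth, so layering by half the depth bounds the width. Bags containing a
given vertex form a subtree of `T` because a walk around the part of the radial tree below that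
vertex crosses only edges of `T` (`iff_of_touchesBelow`), unless it meets an exceptional flag, when
the vertex is in every bag. -/

/-! ### Rooted trees -/

/-- In a connected graph every vertex other than the root has a neighbour closer to the root. -/
theorem SimpleGraph.Connected.exists_parent {N : Type*} {R : SimpleGraph N} (hR : R.Connected)
    (r : N) : ∃ p : N → N, p r = r ∧ ∀ z, z ≠ r → R.Adj z (p z) ∧
      R.dist r (p z) + 1 = R.dist r z := by
  classical
  have key : ∀ z, z ≠ r → ∃ u, R.Adj z u ∧ R.dist r u + 1 = R.dist r z := by
    intro z hz
    obtain ⟨q, hq⟩ := hR.exists_walk_length_eq_dist z r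
    cases q with
    | nil => exact absurd rfl hz
    | cons h q =>
      rename_i u
      refine ⟨u, h, ?_⟩
      have h1 : R.dist u r ≤ q.length := SimpleGraph.dist_le q
      have h2 : R.dist r z ≤ R.dist r u + R.dist u z := hR.dist_triangle
      have h3 : R.dist u z = 1 := SimpleGraph.dist_eq_one_iff_adj.mpr h.symm
      rw [SimpleGraph.Walk.length_cons, SimpleGraph.dist_comm] at hq
      rw [SimpleGraph.dist_comm] at h1
      omega
  choose! f hf using key
  refine ⟨fun z => if z = r then r else f z, by simp, fun z hz => ?_⟩
  simpa [hz] using hf z hz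

/-- Paths from the root are unique, so only one neighbour of a node is closer to the root, and every
tree edge joins a node to its parent. -/
theorem SimpleGraph.IsTree.exists_parent {ι : Type*} {T : SimpleGraph ι} (hT : T.IsTree) (r : ι) :
    ∃ p : ι → ι, p r = r ∧ (∀ z, z ≠ r → T.dist r (p z) < T.dist r z) ∧
      ∀ a b, T.Adj a b → b = p a ∨ a = p b := by
  classical
  obtain ⟨p, hpr, hp⟩ := hT.connected.exists_parent r
  have key : ∀ a b, T.Adj a b → T.dist r b + 1 = T.dist r a → b = p a := by
    intro a b hab hd
    have har : a ≠ r := by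
      rintro rfl
      simp at hd
    obtain ⟨hpa, hpd⟩ := hp a har
    obtain ⟨q₁, hq₁⟩ := hT.connected.exists_walk_length_eq_dist r b
    obtain ⟨q₂, hq₂⟩ := hT.connected.exists_walk_length_eq_dist r (p a)
    have h₁ : (q₁.concat hab.symm).IsPath :=
      SimpleGraph.Walk.isPath_of_length_eq_dist _ (by
        rw [SimpleGraph.Walk.length_concat]; omega)
    have h₂ : (q₂.concat hpa.symm).IsPath :=
      SimpleGraph.Walk.isPath_of_length_eq_dist _ (by
        rw [SimpleGraph.Walk.length_concat]; omega)
    have h := (hT.existsUnique_path r a).unique h₁ h₂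
    have h' := congrArg SimpleGraph.Walk.penultimate h
    simpa using h'
  refine ⟨p, hpr, fun z hz => by have := (hp z hz).2; omega, fun a b hab => ?_⟩
  rcases hT.dist_eq_dist_add_one_of_adj r hab with h | h
  · exact Or.inl (key a b hab h.symm)
  · exact Or.inr (key b a hab.symm h.symm)

/-- The descendants of `y` under the parent function `p`. -/
def descendants {ι : Type*} (p : ι → ι) (y : ι) : Set ι := {z | ∃ n, p^[n] z = y}

theorem self_mem_descendants {ι : Type*} (p : ι → ι) (y : ι) : y ∈ descendants p y := ⟨0, rfl⟩

theorem mem_descendants_of_parent {ι : Type*} {p : ι → ι} {y z : ι} (h : p z ∈ descendants p y) :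
    z ∈ descendants p y := by
  obtain ⟨n, hn⟩ := h
  exact ⟨n + 1, by rwa [Function.iterate_succ_apply]⟩

theorem eq_or_parent_mem_descendants {ι : Type*} {p : ι → ι} {y z : ι}
    (h : z ∈ descendants p y) : z = y ∨ p z ∈ descendants p y := by
  obtain ⟨n, hn⟩ := h
  cases n with
  | zero => exact Or.inl hn
  | succ n => exact Or.inr ⟨n, by rwa [Function.iterate_succ_apply] at hn⟩

theorem mem_descendants_child {ι : Type*} {p : ι → ι} {x z : ι} (h : z ∈ descendants p x) :
    z = x ∨ ∃ y, y ≠ x ∧ p y = x ∧ z ∈ descendants p y := by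
  obtain ⟨n, hn⟩ := h
  induction n with
  | zero => exact Or.inl hn
  | succ n ih =>
    by_cases hx : p^[n] z = x
    · exact ih hx
    · exact Or.inr ⟨p^[n] z, hx, by rwa [Function.iterate_succ_apply'] at hn, n, rfl⟩

theorem descendants_trans {ι : Type*} {p : ι → ι} {x y : ι} (h : p y = x) :
    descendants p y ⊆ descendants p x := by
  rintro z ⟨n, hn⟩
  exact ⟨n + 1, by rw [Function.iterate_succ_apply', hn, h]⟩

theorem descendants_root {ι : Type*} {p : ι → ι} {r : ι} {d : ι → ℕ}
    (hd : ∀ z, z ≠ r → d (p z) < d z) (z : ι) : z ∈ descendants p r := by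
  induction hz : d z using Nat.strong_induction_on generalizing z with
  | _ n ih =>
    by_cases h : z = r
    · exact h ▸ self_mem_descendants p r
    · exact mem_descendants_of_parent (ih _ (hz ▸ hd z h) _ rfl)

/-- A family of bags over a rooted tree with parent function `p` in which the bags containing a
given vertex induce a subtree: if that subtree has nodes on both sides of the tree edge from `y` to
its parent then it contains the parent. -/
def CutConnected {ι : Type*} {V : Type*} (p : ι → ι) (bag : ι → Finset V) : Prop :=
  ∀ v y i j, i ∈ descendants p y → j ∉ descendants p y → v ∈ bag i → v ∈ bag j → v ∈ bag (p y)

/-- A walk inside `X` that leaves the descendants of `y` can do so only along the tree edge from `y`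
to `p y`. -/
theorem mem_parent_of_connected {ι : Type*} {T : SimpleGraph ι} {p : ι → ι}
    (hp : ∀ a b, T.Adj a b → b = p a ∨ a = p b) {X : Set ι} (hX : (T.induce X).Preconnected)
    {y i j : ι} (hi : i ∈ descendants p y) (hj : j ∉ descendants p y) (hiX : i ∈ X) (hjX : j ∈ X) :
    p y ∈ X := by
  obtain ⟨q⟩ := hX ⟨i, hiX⟩ ⟨j, hjX⟩
  obtain ⟨⟨⟨a, b⟩, hab⟩, -, ha, hb⟩ :=
    q.exists_boundary_dart {z : X | (z : ι) ∈ descendants p y} hi hj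
  simp only [Set.mem_ofPred_eq] at ha hb
  rcases hp a b hab with h | h
  · rcases eq_or_parent_mem_descendants ha with h' | h'
    · rw [← h', ← h]
      exact b.2
    · exact absurd (h ▸ h') hb
  · exact absurd (mem_descendants_of_parent (h ▸ ha)) hb

/-! ### Separations -/

/-- For every set `S` of at least `14 k` vertices of `U` there is a separation of order at most `k`
with at least `4 k` vertices of `S` strictly on either side. -/
def HasSeparations {V : Type*} [Fintype V] [DecidableEq V] (G : SimpleGraph V) (U : Finset V)
    (k : ℕ) : Prop :=
  ∀ S ⊆ U, 14 * k ≤ S.card → ∃ A B : Finset V, A ∪ B = Finset.univ ∧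
    (∀ a ∈ A, a ∉ B → ∀ b ∈ B, b ∉ A → ¬ G.Adj a b) ∧ (A ∩ B).card ≤ k ∧
    4 * k ≤ (S ∩ (A \ B)).card ∧ 4 * k ≤ (S ∩ (B \ A)).card

/-- Take a deepest node `x` with at least `5 * k` vertices of `S` below it, and a minimal set `Y` of
children which together with the bag of `x` still captures `5 * k` of them. Each child alone
captures fewer than `5 * k`, so `Y` captures fewer than `10 * k`. The bag of `x` is the separator:
at least `5 * k - k` vertices of `S` are strictly inside and more than `14 * k - 10 * k` outside. -/
theorem hasSeparations_of_cutConnected {V : Type*} [Fintype V] [DecidableEq V]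
    {G : SimpleGraph V} {ι : Type*} [Finite ι] {p : ι → ι} {r : ι} {d : ι → ℕ}
    (hd : ∀ z, z ≠ r → d (p z) < d z) (hr : p r = r) {bag : ι → Finset V}
    (hcut : CutConnected p bag) {U : Finset V} (hU : ∀ v ∈ U, ∃ i, v ∈ bag i)
    (hG : ∀ u v, G.Adj u v → ∃ i, u ∈ bag i ∧ v ∈ bag i) {k : ℕ} (hk : 1 ≤ k)
    (hbag : ∀ i, (bag i).card ≤ k) : HasSeparations G U k := by
  classical
  have := Fintype.ofFinite ι
  intro S hSU hS
  let below : ι → Finset V := fun y => Finset.univ.filter fun v => ∃ i ∈ descendants p y, v ∈ bag i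
  obtain ⟨x, hx, hmax⟩ := Finset.exists_max_image
    (Finset.univ.filter fun x => 5 * k ≤ (S ∩ below x).card) d ⟨r, by
      have : S ∩ below r = S := by
        refine Finset.inter_eq_left.mpr fun v hv => ?_
        obtain ⟨i, hi⟩ := hU v (hSU hv)
        simp only [below, Finset.mem_filter, Finset.mem_univ, true_and]
        exact ⟨i, descendants_root hd i, hi⟩
      simp only [Finset.mem_filter, Finset.mem_univ, true_and, this]
      omega⟩
  simp only [Finset.mem_filter, Finset.mem_univ, true_and] at hx hmax
  have hdx : ∀ y, y ≠ x → p y = x → d x < d y := by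
    intro y hy hyx
    by_cases h : y = r
    · exact absurd (by rw [← hyx, h, hr]) hy
    · exact hyx ▸ hd y h
  have hdesc : ∀ y, y ≠ x → p y = x → x ∉ descendants p y := by
    rintro y hy hyx ⟨n, hn⟩
    have hle : ∀ n z, d (p^[n] z) ≤ d z := by
      intro n
      induction n with
      | zero => intro z; exact le_rfl
      | succ n ih =>
        intro z
        rw [Function.iterate_succ_apply]
        by_cases h : z = r
        · rw [h, hr]; exact ih r
        · exact (ih _).trans (hd z h).le
    have := hle n x
    rw [hn] at this
    exact absurd (hdx y hy hyx) (by omega)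
  let children : Finset ι := Finset.univ.filter fun y => y ≠ x ∧ p y = x
  let side : Finset ι → Finset V := fun Y => bag x ∪ Y.biUnion below
  have hall : 5 * k ≤ (S ∩ side children).card := by
    refine hx.trans (Finset.card_le_card (Finset.inter_subset_inter_left fun v hv => ?_))
    simp only [below, Finset.mem_filter, Finset.mem_univ, true_and] at hv
    obtain ⟨i, hi, hv⟩ := hv
    simp only [side, children, below, Finset.mem_union, Finset.mem_biUnion, Finset.mem_filter,
      Finset.mem_univ, true_and]
    rcases mem_descendants_child hi with rfl | ⟨y, hy, hyx, hiy⟩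
    · exact Or.inl hv
    · exact Or.inr ⟨y, ⟨hy, hyx⟩, i, hiy, hv⟩
  obtain ⟨Y, hY, hYmin⟩ := Finset.exists_min_image
    (children.powerset.filter fun Y => 5 * k ≤ (S ∩ side Y).card) Finset.card
    ⟨children, by simpa using hall⟩
  simp only [Finset.mem_filter, Finset.mem_powerset] at hY hYmin
  obtain ⟨hYc, hY5⟩ := hY
  have hY10 : (S ∩ side Y).card < 10 * k := by
    rcases Y.eq_empty_or_nonempty with h0 | ⟨y, hy⟩
    · have h1 : (S ∩ side Y).card ≤ (bag x).card := by
        refine Finset.card_le_card ?_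
        rw [h0]
        simp only [side, Finset.biUnion_empty, Finset.union_empty]
        exact Finset.inter_subset_right
      have := hbag x
      omega
    · have h1 : (S ∩ side (Y.erase y)).card < 5 * k := by
        by_contra hcon
        have := hYmin (Y.erase y) ⟨(Finset.erase_subset _ _).trans hYc, by omega⟩
        exact absurd this (by have := Finset.card_erase_lt_of_mem hy; omega)
      have h2 : (S ∩ below y).card < 5 * k := by
        by_contra hcon
        have hyc := hYc hy
        simp only [children, Finset.mem_filter, Finset.mem_univ, true_and] at hyc
        have := hmax y (by omega)
        exact absurd (hdx y hyc.1 hyc.2) (by omega)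
      have h3 : S ∩ side Y ⊆ (S ∩ side (Y.erase y)) ∪ (S ∩ below y) := by
        intro v hv
        simp only [side, Finset.mem_union, Finset.mem_inter, Finset.mem_biUnion,
          Finset.mem_erase] at hv ⊢
        obtain ⟨hvS, hv | ⟨z, hz, hv⟩⟩ := hv
        · exact Or.inl ⟨hvS, Or.inl hv⟩
        · by_cases hzy : z = y
          · exact Or.inr ⟨hvS, hzy ▸ hv⟩
          · exact Or.inl ⟨hvS, Or.inr ⟨z, ⟨hzy, hz⟩, hv⟩⟩
      have h4 := (Finset.card_le_card h3).trans (Finset.card_union_le _ _)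
      omega
  have hbx : bag x ⊆ side Y := Finset.subset_union_left
  have hAB : side Y ∩ (Finset.univ \ (side Y \ bag x)) = bag x := by
    ext v
    have := @hbx v
    simp only [Finset.mem_inter, Finset.mem_sdiff, Finset.mem_univ, true_and, not_and, not_not]
    tauto
  have hAdB : side Y \ (Finset.univ \ (side Y \ bag x)) = side Y \ bag x := by
    ext v
    simp
  have hBdA : (Finset.univ \ (side Y \ bag x)) \ side Y = Finset.univ \ side Y := by
    ext v
    have := @hbx v
    simp only [Finset.mem_sdiff, Finset.mem_univ, true_and]
    tauto
  refine ⟨side Y, Finset.univ \ (side Y \ bag x), ?_, ?_, ?_, ?_, ?_⟩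
  · ext v
    simp only [Finset.mem_union, Finset.mem_sdiff, Finset.mem_univ, true_and, iff_true]
    tauto
  · intro a ha haB b hb hbA hab
    have hax : a ∉ bag x := fun h => haB (by simp [h])
    simp only [side, Finset.mem_union, hax, false_or, Finset.mem_biUnion] at ha
    obtain ⟨y, hy, hay⟩ := ha
    have hyc := hYc hy
    simp only [children, below, Finset.mem_filter, Finset.mem_univ, true_and] at hyc hay
    obtain ⟨i, hi, hai⟩ := hay
    obtain ⟨j, haj, hbj⟩ := hG a b hab
    by_cases hj : j ∈ descendants p y
    · refine hbA ?_
      simp only [side, below, Finset.mem_union, Finset.mem_biUnion, Finset.mem_filter,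
        Finset.mem_univ, true_and]
      exact Or.inr ⟨y, hy, j, hj, hbj⟩
    · exact hax (hyc.2 ▸ hcut a y i j hi hj hai haj)
  · rw [hAB]
    exact hbag x
  · rw [hAdB]
    have h1 : S ∩ side Y ⊆ (S ∩ (side Y \ bag x)) ∪ bag x := by
      intro v hv
      simp only [Finset.mem_union, Finset.mem_inter, Finset.mem_sdiff] at hv ⊢
      tauto
    have h2 := (Finset.card_le_card h1).trans (Finset.card_union_le _ _)
    have := hbag x
    omega
  · rw [hBdA]
    have h1 : S ⊆ (S ∩ side Y) ∪ (S ∩ (Finset.univ \ side Y)) := by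
      intro v hv
      simp only [Finset.mem_union, Finset.mem_inter, Finset.mem_sdiff, Finset.mem_univ, true_and]
      tauto
    have h2 := (Finset.card_le_card h1).trans (Finset.card_union_le _ _)
    omega

/-! ### 2-colorings of graphs of bounded treewidth and maximum degree -/

/-- Every vertex of `U` lies in a set of at most `M` vertices that is closed under taking
monochromatic neighbours in `U`. -/
def SmallMonochromatic {V β : Type*} (G : SimpleGraph V) (c : V → β) (U : Finset V) (M : ℕ) :
    Prop :=
  ∀ v ∈ U, ∃ K : Finset V, v ∈ K ∧ K.card ≤ M ∧
    ∀ x ∈ K, ∀ y ∈ U, G.Adj x y → c x = c y → y ∈ K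

theorem card_filter_exists_adj_le {V : Type*} [Fintype V] [DecidableEq V]
    (G : SimpleGraph V) [DecidableRel G.Adj] {D : ℕ}
    (hdeg : ∀ v, (Finset.univ.filter (G.Adj v)).card ≤ D) (S : Finset V) :
    (S.biUnion fun v => Finset.univ.filter (G.Adj v)).card ≤ S.card * D :=
  Finset.card_biUnion_le_card_mul _ _ _ fun v _ => hdeg v

/-- The prescribed set `S` is what makes the induction on `U` work: colorings of the two sides of a
separation are glued by prescribing the separator on both. `R` contains the components that meet
`S`. The slack `4 * k` in its size bound pays for counting the separator on both sides. -/
theorem exists_coloring_of_hasSeparations_aux {V : Type*} [Fintype V] [DecidableEq V]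
    {G : SimpleGraph V} [DecidableRel G.Adj] {U₀ : Finset V} {k D : ℕ} (hk : 1 ≤ k) (hD : 1 ≤ D)
    (hsep : HasSeparations G U₀ k) (hdeg : ∀ v, (Finset.univ.filter (G.Adj v)).card ≤ D)
    (U : Finset V) (hU : U ⊆ U₀) (S : Finset V) (hSU : S ⊆ U) (hS : 4 * k ≤ S.card) :
    ∃ (c : V → Bool) (R : Finset V), S ⊆ R ∧ R ⊆ U ∧ (∀ x ∈ R, c x = true) ∧
      (∀ x ∈ R, ∀ y ∈ U, G.Adj x y → c y = true → y ∈ R) ∧ R.card + 4 * k ≤ 2 * S.card ∧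
      ∀ v ∈ U, v ∉ R → ∃ K : Finset V, v ∈ K ∧ K.card ≤ 28 * k * D ∧
        ∀ x ∈ K, ∀ y ∈ U, G.Adj x y → c x = c y → y ∈ K := by
  have hkD : k ≤ k * D := Nat.le_mul_of_pos_right k hD
  rw [mul_assoc 28 k D]
  induction hn : U.card using Nat.strong_induction_on generalizing U S with
  | _ n ih =>
  subst hn
  by_cases hs : S.card < 14 * k
  · let U' := U \ S
    by_cases hU' : U'.card ≤ 4 * k
    · refine ⟨fun x => decide (x ∈ S), S, subset_rfl, hSU, by simp, by simp, by omega, ?_⟩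
      intro v hv hvS
      refine ⟨U', by simp [U', hv, hvS], by omega, ?_⟩
      intro x hx y hy _ hc
      have hxS : x ∉ S := by simp only [U', Finset.mem_sdiff] at hx; exact hx.2
      simp only [hxS, decide_false] at hc
      have : y ∉ S := by simpa using hc.symm
      simp [U', hy, this]
    · let N := U' ∩ S.biUnion fun v => Finset.univ.filter (G.Adj v)
      have hN : N.card ≤ 14 * (k * D) := by
        refine (Finset.card_le_card Finset.inter_subset_right).trans
          ((card_filter_exists_adj_le G hdeg S).trans ?_)
        calc S.card * D ≤ 14 * k * D := Nat.mul_le_mul_right D hs.le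
          _ = _ := by ring
      obtain ⟨S', hNS', hS'U, hS'⟩ := Finset.exists_subsuperset_card_eq
        (s := N) (t := U') (n := max N.card (4 * k)) Finset.inter_subset_left (le_max_left _ _)
        (max_le (Finset.card_le_card Finset.inter_subset_left) (by omega))
      have hlt : U'.card < U.card := by
        refine Finset.card_lt_card (Finset.sdiff_ssubset hSU (Finset.card_pos.mp (by omega)))
      have hU'U : U' ⊆ U := Finset.sdiff_subset
      obtain ⟨c, R, hSR, hRU, hRc, hRcl, hRcard, hK⟩ := ih _ hlt U' (hU'U.trans hU) S' hS'U
        (by rw [hS']; exact le_max_right _ _) rfl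
      have hmemN : ∀ x ∈ S, ∀ y ∈ U, y ∉ S → G.Adj x y → y ∈ R := by
        intro x hx y hy hyS hxy
        refine hSR (hNS' ?_)
        simp only [N, U', Finset.mem_inter, Finset.mem_sdiff, Finset.mem_biUnion,
          Finset.mem_filter, Finset.mem_univ, true_and]
        exact ⟨⟨hy, hyS⟩, x, hx, hxy⟩
      have hU'S : ∀ x ∈ U', x ∉ S := fun x hx => (Finset.mem_sdiff.mp hx).2
      -- Negating the recursive coloring makes every neighbour of `S` in `U'` false, which isolates
      -- `S`.
      refine ⟨fun x => if x ∈ S then true else !c x, S, subset_rfl, hSU, ?_, ?_, by omega, ?_⟩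
      · intro x hx
        simp [hx]
      · intro x hx y hy hxy hc
        by_contra hyS
        have := hRc y (hmemN x hx y hy hyS hxy)
        simp [hyS, this] at hc
      · intro v hv hvS
        by_cases hvR : v ∈ R
        · refine ⟨R, hvR, by omega, ?_⟩
          intro x hx y hy hxy hc
          have hxS := hU'S x (hRU hx)
          have hxc := hRc x hx
          by_cases hyS : y ∈ S
          · simp [hxS, hyS, hxc] at hc
          · refine hRcl x hx y (by simp [U', hy, hyS]) hxy ?_
            simpa [hxS, hyS, hxc] using hc.symm
        · obtain ⟨K, hvK, hKcard, hKcl⟩ := hK v (by simp [U', hv, hvS]) hvR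
          refine ⟨K ∩ U', by simp [U', hv, hvS, hvK],
            (Finset.card_le_card Finset.inter_subset_left).trans (by omega), ?_⟩
          intro x hx y hy hxy hc
          rw [Finset.mem_inter] at hx
          have hxS := hU'S x hx.2
          by_cases hyS : y ∈ S
          · have hxR := hmemN y hyS x (hU'U hx.2) hxS hxy.symm
            simp [hxS, hyS, hRc x hxR] at hc
          · have hyU : y ∈ U' := by simp [U', hy, hyS]
            refine Finset.mem_inter.mpr ⟨hKcl x hx.1 y hyU hxy ?_, hyU⟩
            simpa [hxS, hyS] using hc
  · obtain ⟨A, B, hAB, hadj, hZ, hA, hB⟩ := hsep S (hSU.trans hU) (by omega)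
    have hcov : ∀ x, x ∈ A ∨ x ∈ B := fun x => by
      rw [← Finset.mem_union, hAB]; exact Finset.mem_univ x
    have hbal : ∀ A B : Finset V, (A ∩ B).card ≤ k → 4 * k ≤ (S ∩ (A \ B)).card →
        4 * k ≤ (S ∩ (B \ A)).card → ∃ (c : V → Bool) (R : Finset V),
        (S ∩ A) ∪ (U ∩ A ∩ B) ⊆ R ∧ R ⊆ U ∩ A ∧ (∀ x ∈ R, c x = true) ∧
        (∀ x ∈ R, ∀ y ∈ U ∩ A, G.Adj x y → c y = true → y ∈ R) ∧
        -- The subtraction does not truncate, as `S ∩ (A \ B)` has at least `4 * k` vertices. Summed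
        -- over both sides, the separator costs at most `4 * k` and the slack is `8 * k`, which
        -- leaves the required `4 * k`.
        R.card + 2 * k ≤ 2 * (S ∩ (A \ B)).card + (A ∩ B).card + (A ∩ B).card - 2 * k ∧
        ∀ v ∈ U ∩ A, v ∉ R → ∃ K : Finset V, v ∈ K ∧ K.card ≤ 28 * (k * D) ∧
          ∀ x ∈ K, ∀ y ∈ U ∩ A, G.Adj x y → c x = c y → y ∈ K := by
      intro A B hZ hA hB
      have hlt : (U ∩ A).card < U.card := by
        refine Finset.card_lt_card ⟨Finset.inter_subset_left, fun h => ?_⟩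
        obtain ⟨z, hz⟩ := Finset.card_pos.mp (show 0 < (S ∩ (B \ A)).card by omega)
        simp only [Finset.mem_inter, Finset.mem_sdiff] at hz
        exact hz.2.2 (Finset.mem_inter.mp (h (hSU hz.1))).2
      have h1 : (S ∩ A) ∪ (U ∩ A ∩ B) ⊆ (S ∩ (A \ B)) ∪ (A ∩ B) := by
        intro x hx
        simp only [Finset.mem_union, Finset.mem_inter, Finset.mem_sdiff] at hx ⊢
        tauto
      have h2 := (Finset.card_le_card h1).trans (Finset.card_union_le _ _)
      have h3 : S ∩ (A \ B) ⊆ (S ∩ A) ∪ (U ∩ A ∩ B) := by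
        intro x hx
        simp only [Finset.mem_union, Finset.mem_inter, Finset.mem_sdiff] at hx ⊢
        tauto
      obtain ⟨c, R, hSR, hRU, hRc, hRcl, hRcard, hK⟩ := ih _ hlt (U ∩ A)
        (Finset.inter_subset_left.trans hU) ((S ∩ A) ∪ (U ∩ A ∩ B))
        (by
          intro x hx
          have := @hSU x
          simp only [Finset.mem_union, Finset.mem_inter] at hx ⊢
          tauto)
        (hA.trans (Finset.card_le_card h3)) rfl
      exact ⟨c, R, hSR, hRU, hRc, hRcl, by omega, hK⟩
    obtain ⟨c₁, R₁, hSR₁, hRU₁, hRc₁, hRcl₁, hRcard₁, hK₁⟩ := hbal A B hZ hA hB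
    obtain ⟨c₂, R₂, hSR₂, hRU₂, hRc₂, hRcl₂, hRcard₂, hK₂⟩ :=
      hbal B A (by rwa [Finset.inter_comm]) hB hA
    rw [Finset.inter_comm B A] at hRcard₂
    have hZ₁ : ∀ x ∈ U, x ∈ A → x ∈ B → x ∈ R₁ := fun x hx hxA hxB =>
      hSR₁ (by simp [hx, hxA, hxB])
    have hZ₂ : ∀ x ∈ U, x ∈ A → x ∈ B → x ∈ R₂ := fun x hx hxA hxB =>
      hSR₂ (by simp [hx, hxA, hxB])
    let c : V → Bool := fun x => if x ∈ A then c₁ x else c₂ x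
    have hcA : ∀ x ∈ A, c x = c₁ x := fun x hx => by simp [c, hx]
    have hcB : ∀ x ∈ U, x ∈ B → c x = c₂ x := by
      intro x hx hxB
      by_cases hxA : x ∈ A
      · rw [hcA x hxA, hRc₁ x (hZ₁ x hx hxA hxB), hRc₂ x (hZ₂ x hx hxA hxB)]
      · simp [c, hxA]
    have hU₁ : ∀ x ∈ R₁, x ∈ U ∧ x ∈ A := fun x hx => Finset.mem_inter.mp (hRU₁ hx)
    have hU₂ : ∀ x ∈ R₂, x ∈ U ∧ x ∈ B := fun x hx => Finset.mem_inter.mp (hRU₂ hx)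
    have hclos : ∀ x ∈ R₁ ∪ R₂, ∀ y ∈ U, G.Adj x y → c y = true → y ∈ R₁ ∪ R₂ := by
      intro x hx y hy hxy hc
      have hxU : x ∈ U := by
        rcases Finset.mem_union.mp hx with h | h
        exacts [(hU₁ x h).1, (hU₂ x h).1]
      have hx₁ : x ∈ A → x ∈ R₁ := fun hA => by
        rcases Finset.mem_union.mp hx with h | h
        exacts [h, hZ₁ x hxU hA (hU₂ x h).2]
      have hx₂ : x ∈ B → x ∈ R₂ := fun hB => by
        rcases Finset.mem_union.mp hx with h | h
        exacts [hZ₂ x hxU (hU₁ x h).2 hB, h]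
      rw [Finset.mem_union]
      by_cases hA : x ∈ A ∧ y ∈ A
      · exact Or.inl (hRcl₁ x (hx₁ hA.1) y (Finset.mem_inter.mpr ⟨hy, hA.2⟩) hxy
          (by rw [← hcA y hA.2, hc]))
      · have hB : x ∈ B ∧ y ∈ B := by
          by_contra hcon
          rcases hcov x with h | h <;> rcases hcov y with h' | h'
          · exact hA ⟨h, h'⟩
          · exact hadj x h (fun hb => hcon ⟨hb, h'⟩) y h' (fun ha => hA ⟨h, ha⟩) hxy
          · exact hadj y h' (fun hb => hcon ⟨h, hb⟩) x h (fun ha => hA ⟨ha, h'⟩) hxy.symm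
          · exact hcon ⟨h, h'⟩
        exact Or.inr (hRcl₂ x (hx₂ hB.1) y (Finset.mem_inter.mpr ⟨hy, hB.2⟩) hxy
          (by rw [← hcB y hy hB.2, hc]))
    have hRc : ∀ x ∈ R₁ ∪ R₂, c x = true := by
      intro x hx
      rcases Finset.mem_union.mp hx with h | h
      · rw [hcA x (hU₁ x h).2, hRc₁ x h]
      · rw [hcB x (hU₂ x h).1 (hU₂ x h).2, hRc₂ x h]
    have hglue : ∀ (A B : Finset V) (c' : V → Bool), (∀ x, x ∈ A ∨ x ∈ B) →
        (∀ a ∈ A, a ∉ B → ∀ b ∈ B, b ∉ A → ¬ G.Adj a b) →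
        (∀ x ∈ U, x ∈ A → c x = c' x) →
        (∀ x ∈ U, x ∈ A → x ∈ B → x ∈ R₁ ∪ R₂) → ∀ v, v ∈ A → v ∈ U → v ∉ R₁ ∪ R₂ →
        ∀ K : Finset V, v ∈ K → K.card ≤ 28 * (k * D) →
        (∀ x ∈ K, ∀ y ∈ U ∩ A, G.Adj x y → c' x = c' y → y ∈ K) →
        ∃ K : Finset V, v ∈ K ∧ K.card ≤ 28 * (k * D) ∧
          ∀ x ∈ K, ∀ y ∈ U, G.Adj x y → c x = c y → y ∈ K := by
      intro A B c' hcov hadj hcA hZ v hvA hvU hvR K hvK hKcard hKcl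
      -- Removing `R₁ ∪ R₂` removes the separator, so no edge leads from this set to the other side;
      -- it stays closed because `R₁ ∪ R₂` is itself closed under monochromatic neighbours.
      refine ⟨(K ∩ (U ∩ A)) \ (R₁ ∪ R₂), by simp [hvK, hvU, hvA] at hvR ⊢; exact hvR,
        (Finset.card_le_card (Finset.sdiff_subset.trans Finset.inter_subset_left)).trans hKcard,
        ?_⟩
      intro x hx y hy hxy hc
      rw [Finset.mem_sdiff, Finset.mem_inter, Finset.mem_inter] at hx
      obtain ⟨⟨hxK, hxU, hxA⟩, hxR⟩ := hx
      have hxB : x ∉ B := fun hxB => hxR (hZ x hxU hxA hxB)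
      have hyA : y ∈ A := by
        by_contra hyA
        exact hadj x hxA hxB y ((hcov y).resolve_left hyA) hyA hxy
      have hyK := hKcl x hxK y (Finset.mem_inter.mpr ⟨hy, hyA⟩) hxy
        (by rw [← hcA x hxU hxA, ← hcA y hy hyA, hc])
      rw [Finset.mem_sdiff, Finset.mem_inter, Finset.mem_inter]
      refine ⟨⟨hyK, hy, hyA⟩, fun hyR => hxR ?_⟩
      exact hclos y hyR x hxU hxy.symm (by rw [hc, hRc y hyR])
    refine ⟨c, R₁ ∪ R₂, ?_, ?_, hRc, hclos, ?_, ?_⟩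
    · intro x hx
      rw [Finset.mem_union]
      rcases hcov x with h | h
      · exact Or.inl (hSR₁ (by simp [hx, h]))
      · exact Or.inr (hSR₂ (by simp [hx, h]))
    · exact Finset.union_subset (hRU₁.trans Finset.inter_subset_left)
        (hRU₂.trans Finset.inter_subset_left)
    · have h1 := Finset.card_union_le R₁ R₂
      have h2 : (S ∩ (A \ B)).card + (S ∩ (B \ A)).card ≤ S.card := by
        rw [← Finset.card_union_of_disjoint]
        · exact Finset.card_le_card (Finset.union_subset Finset.inter_subset_left
            Finset.inter_subset_left)
        · rw [Finset.disjoint_left]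
          intro x hx hx'
          simp only [Finset.mem_inter, Finset.mem_sdiff] at hx hx'
          exact hx.2.2 hx'.2.1
      omega
    · intro v hv hvR
      have hvR' := hvR
      rw [Finset.mem_union, not_or] at hvR'
      rcases hcov v with h | h
      · obtain ⟨K, h1, h2, h3⟩ := hK₁ v (by simp [hv, h]) hvR'.1
        exact hglue A B c₁ hcov hadj (fun x _ hx => hcA x hx)
          (fun x hx hxA hxB => Finset.mem_union_left _ (hZ₁ x hx hxA hxB)) v h hv hvR K h1 h2 h3
      · obtain ⟨K, h1, h2, h3⟩ := hK₂ v (by simp [hv, h]) hvR'.2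
        exact hglue B A c₂ (fun x => (hcov x).symm)
          (fun a ha ha' b hb hb' hab => hadj b hb hb' a ha ha' hab.symm) hcB
          (fun x hx hxB hxA => Finset.mem_union_left _ (hZ₁ x hx hxA hxB)) v h hv hvR K h1 h2 h3

theorem exists_coloring_of_hasSeparations {V : Type*} [Fintype V] [DecidableEq V]
    {G : SimpleGraph V} [DecidableRel G.Adj] {U : Finset V} {k D : ℕ} (hk : 1 ≤ k) (hD : 1 ≤ D)
    (hsep : HasSeparations G U k) (hdeg : ∀ v, (Finset.univ.filter (G.Adj v)).card ≤ D) :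
    ∃ c : V → Bool, SmallMonochromatic G c U (28 * k * D) := by
  have hkD : k ≤ k * D := Nat.le_mul_of_pos_right k hD
  have hassoc : 28 * k * D = 28 * (k * D) := by ring
  by_cases h : 4 * k ≤ U.card
  -- Any `4 * k` vertices may be prescribed; the size bound then gives at most `4 * k` vertices in
  -- `R`.
  · obtain ⟨S, hSU, hS⟩ := Finset.exists_subset_card_eq h
    obtain ⟨c, R, hSR, -, hRc, hRcl, hRcard, hK⟩ :=
      exists_coloring_of_hasSeparations_aux hk hD hsep hdeg U subset_rfl S hSU hS.ge
    refine ⟨c, fun v hv => ?_⟩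
    by_cases hvR : v ∈ R
    · exact ⟨R, hvR, by omega, fun x hx y hy hxy hc => hRcl x hx y hy hxy (hc ▸ hRc x hx)⟩
    · exact hK v hv hvR
  · exact ⟨fun _ => true, fun v hv => ⟨U, hv, by omega, fun _ _ y hy _ _ => hy⟩⟩

/-! ### Extending a coloring while controlling the clusters of a given set -/

/-- Every vertex of `U` lies in a set of at most `M` vertices that is closed under taking
neighbours in `U`; that is, `G[U]` has components of at most `M` vertices. -/
def SmallComponents {V : Type*} (G : SimpleGraph V) (U : Finset V) (M : ℕ) : Prop :=
  ∀ v ∈ U, ∃ K : Finset V, v ∈ K ∧ K.card ≤ M ∧ ∀ x ∈ K, ∀ y ∈ U, G.Adj x y → y ∈ K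

theorem SmallComponents.mono {V : Type*} {G : SimpleGraph V} {U U' : Finset V} {M M' : ℕ}
    (h : SmallComponents G U M) (hU : U' ⊆ U) (hM : M ≤ M') : SmallComponents G U' M' := by
  intro v hv
  obtain ⟨K, hvK, hK, hcl⟩ := h v (hU hv)
  exact ⟨K, hvK, hK.trans hM, fun x hx y hy => hcl x hx y (hU hy)⟩

/-- `u` is reachable from `v` by a walk whose vertices after `v` are all in `W`. -/
def ReachesThrough {V : Type*} (G : SimpleGraph V) (W : Finset V) (v u : V) : Prop :=
  Relation.ReflTransGen (fun a b => G.Adj a b ∧ b ∈ W) v u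

namespace ReachesThrough

variable {V : Type*} {G : SimpleGraph V} {W : Finset V} {v u : V}

theorem eq_or_mem (h : ReachesThrough G W v u) : v = u ∨ u ∈ W := by
  cases Relation.ReflTransGen.cases_tail h with
  | inl h => exact Or.inl h.symm
  | inr h =>
    obtain ⟨_, _, _, h⟩ := h
    exact Or.inr h

theorem symm (h : ReachesThrough G W v u) (hv : v ∈ W) : ReachesThrough G W u v := by
  induction h with
  | refl => exact Relation.ReflTransGen.refl
  | tail hvm hmu ih =>
    rename_i m u
    have hm : m ∈ W := by
      rcases eq_or_mem hvm with h | h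
      exacts [h ▸ hv, h]
    exact Relation.ReflTransGen.head ⟨hmu.1.symm, hm⟩ ih

theorem mem_of_closed (h : ReachesThrough G W v u) {K : Finset V} (hv : v ∈ K)
    (hK : ∀ x ∈ K, ∀ y ∈ W, G.Adj x y → y ∈ K) : u ∈ K := by
  induction h with
  | refl => exact hv
  | tail _ hmu ih => exact hK _ ih _ hmu.2 hmu.1

theorem exists_adj_of_closed (h : ReachesThrough G W v u) {K : Finset V} (hu : u ∈ K)
    (hK : ∀ x ∈ K, ∀ y ∈ W, G.Adj x y → y ∈ K) : v = u ∨ ∃ b ∈ K, G.Adj b v := by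
  induction h using Relation.ReflTransGen.head_induction_on with
  | refl => exact Or.inl rfl
  | @head a b hab hbu ih =>
    rcases ih with rfl | ⟨b', hb', hbb'⟩
    · exact Or.inr ⟨_, hu, hab.1.symm⟩
    · exact Or.inr ⟨b, hK b' hb' b hab.2 hbb', hab.1.symm⟩

end ReachesThrough

/-- The graph on `X` in which two vertices are adjacent if they are adjacent in `G` or have a
common neighbouring component of `G[W]`. -/
def throughGraph {V : Type*} (G : SimpleGraph V) (X W : Finset V) : SimpleGraph V where
  Adj v w := v ≠ w ∧ v ∈ X ∧ w ∈ X ∧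
    (G.Adj v w ∨ ∃ u ∈ W, ReachesThrough G W v u ∧ ReachesThrough G W w u)
  symm := by
    constructor
    rintro v w ⟨h, hv, hw, h' | ⟨u, hu, h₁, h₂⟩⟩
    · exact ⟨h.symm, hw, hv, Or.inl h'.symm⟩
    · exact ⟨h.symm, hw, hv, Or.inr ⟨u, hu, h₂, h₁⟩⟩
  loopless := by
    constructor
    intro v h
    exact h.1 rfl

section Extension

variable {V : Type*} [Fintype V] [DecidableEq V] {G : SimpleGraph V} [DecidableRel G.Adj]
  {D c : ℕ} {X W : Finset V}

open Classical in
-- Such a `v` has a neighbour in the component of `u`, which has at most `c` vertices, each of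
-- degree at most `D`.
theorem card_filter_reachesThrough_to_le
    (hdeg : ∀ v, (Finset.univ.filter (G.Adj v)).card ≤ D) (hXW : Disjoint X W)
    (hW : SmallComponents G W c) {u : V} (hu : u ∈ W) :
    (X.filter fun v => ReachesThrough G W v u).card ≤ c * D := by
  obtain ⟨K, huK, hK, hcl⟩ := hW u hu
  refine (Finset.card_le_card ?_).trans
    ((card_filter_exists_adj_le G hdeg K).trans (Nat.mul_le_mul_right D hK))
  intro v hv
  rw [Finset.mem_filter] at hv
  rcases hv.2.exists_adj_of_closed huK hcl with rfl | ⟨b, hb, hbv⟩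
  · exact absurd hu (Finset.disjoint_left.mp hXW hv.1)
  · simpa using ⟨b, hb, hbv⟩

open Classical in
theorem card_filter_reachesThrough_from_le
    (hdeg : ∀ v, (Finset.univ.filter (G.Adj v)).card ≤ D)
    (hW : SmallComponents G W c) {v : V} (hv : v ∉ W) :
    (W.filter fun u => ReachesThrough G W v u).card ≤ D * c := by
  choose! K hK using hW
  have hsub : (W.filter fun u => ReachesThrough G W v u) ⊆
      ((Finset.univ.filter (G.Adj v)) ∩ W).biUnion K := by
    intro u hu
    rw [Finset.mem_filter] at hu
    rcases Relation.ReflTransGen.cases_head hu.2 with rfl | ⟨a, ha, hau⟩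
    · exact absurd hu.1 hv
    · simp only [Finset.mem_biUnion, Finset.mem_inter, Finset.mem_filter, Finset.mem_univ,
        true_and]
      exact ⟨a, ha, ReachesThrough.mem_of_closed hau (hK a ha.2).1 (hK a ha.2).2.2⟩
  refine (Finset.card_le_card hsub).trans ((Finset.card_biUnion_le_card_mul _ _ c
    fun a ha => (hK a (Finset.mem_inter.mp ha).2).2.1).trans (Nat.mul_le_mul_right c ?_))
  exact (Finset.card_le_card Finset.inter_subset_left).trans (hdeg v)

open Classical in
theorem card_throughGraph_neighbors_le
    (hdeg : ∀ v, (Finset.univ.filter (G.Adj v)).card ≤ D) (hXW : Disjoint X W)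
    (hW : SmallComponents G W c) (hc : 1 ≤ c) (hD : 1 ≤ D) (v : V) :
    (Finset.univ.filter ((throughGraph G X W).Adj v)).card ≤ 2 * c * D * D := by
  have hsub : Finset.univ.filter ((throughGraph G X W).Adj v) ⊆
      Finset.univ.filter (G.Adj v) ∪ ((Finset.univ.filter (G.Adj v)) ∩ W).biUnion
        fun a => X.filter fun w => ReachesThrough G W w a := by
    intro w hw
    simp only [Finset.mem_filter, Finset.mem_univ, true_and] at hw
    obtain ⟨-, hv, hwX, h | ⟨u, hu, hvu, hwu⟩⟩ := hw
    · simp [h]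
    · rcases Relation.ReflTransGen.cases_head hvu with rfl | ⟨a, ha, hau⟩
      · exact absurd hu (Finset.disjoint_left.mp hXW hv)
      · have hua : ReachesThrough G W u a := ReachesThrough.symm hau ha.2
        simp only [Finset.mem_union, Finset.mem_biUnion, Finset.mem_inter, Finset.mem_filter,
          Finset.mem_univ, true_and]
        exact Or.inr ⟨a, ha, hwX, Relation.ReflTransGen.trans hwu hua⟩
  have h1 := (Finset.card_le_card hsub).trans (Finset.card_union_le _ _)
  have h2 := Finset.card_biUnion_le_card_mul ((Finset.univ.filter (G.Adj v)) ∩ W)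
    (fun a => X.filter fun w => ReachesThrough G W w a) (c * D)
    fun a ha => card_filter_reachesThrough_to_le hdeg hXW hW (Finset.mem_inter.mp ha).2
  have h3 : ((Finset.univ.filter (G.Adj v)) ∩ W).card ≤ D :=
    (Finset.card_le_card Finset.inter_subset_left).trans (hdeg v)
  have h4 := hdeg v
  have h5 : ((Finset.univ.filter (G.Adj v)) ∩ W).card * (c * D) ≤ D * (c * D) :=
    Nat.mul_le_mul_right _ h3
  have h6 : D * 1 ≤ D * (c * D) := Nat.mul_le_mul_left D (Nat.mul_pos hc hD)
  have h7 : 2 * c * D * D = D * (c * D) + D * (c * D) := by ring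
  omega

open Classical in
-- In each bag a vertex of `W` is replaced by all vertices of `X` that reach it, at most `c * D` of
-- them. Since each component is connected, the bags containing a given vertex of `X` still form a
-- subtree.
theorem hasSeparations_throughGraph {ι : Type*} [Finite ι] {p : ι → ι} {r : ι} {d : ι → ℕ}
    (hd : ∀ z, z ≠ r → d (p z) < d z) (hr : p r = r) {bag : ι → Finset V}
    (hcut : CutConnected p bag) (hcov : ∀ v, ∃ i, v ∈ bag i)
    (hG : ∀ u v, G.Adj u v → ∃ i, u ∈ bag i ∧ v ∈ bag i) {k : ℕ} (hk : 1 ≤ k)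
    (hbag : ∀ i, (bag i ∩ (X ∪ W)).card ≤ k)
    (hdeg : ∀ v, (Finset.univ.filter (G.Adj v)).card ≤ D) (hXW : Disjoint X W)
    (hW : SmallComponents G W c) (hc : 1 ≤ c) (hD : 1 ≤ D) :
    HasSeparations (throughGraph G X W) X (k * (c * D)) := by
  let bag' : ι → Finset V := fun i =>
    X.filter fun v => ∃ u ∈ bag i, ReachesThrough G W v u
  have hcD : 1 ≤ c * D := Nat.mul_pos hc hD
  refine hasSeparations_of_cutConnected hd hr (bag := bag') ?_ ?_ ?_ (Nat.mul_pos hk hcD) ?_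
  · intro v y i j hi hj hvi hvj
    simp only [bag', Finset.mem_filter] at hvi hvj ⊢
    obtain ⟨hvX, u, hu, hvu⟩ := hvi
    obtain ⟨-, w, hw, hvw⟩ := hvj
    refine ⟨hvX, ?_⟩
    by_contra hcon
    push Not at hcon
    -- If no vertex reached from `v` is in the bag of `p y`, each of them has all its bags on one
    -- side of the cut, and the side does not change along an edge.
    let inside : V → Prop := fun a => ∃ i ∈ descendants p y, a ∈ bag i
    have hside : ∀ a, ReachesThrough G W v a → ∀ m, a ∈ bag m → inside a →
        m ∈ descendants p y := by
      rintro a hva m ham ⟨i', hi', hai'⟩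
      by_contra hm
      exact hcon a (hcut a y i' m hi' hm hai' ham) hva
    have hiff : ∀ a, ReachesThrough G W v a → (inside v ↔ inside a) := by
      intro a hva
      induction hva with
      | refl => rfl
      | tail hva hab ih =>
        rename_i a b
        rw [ih]
        obtain ⟨m, ham, hbm⟩ := hG a b hab.1
        exact ⟨fun h => ⟨m, hside a hva m ham h, hbm⟩,
          fun h => ⟨m, hside b (Relation.ReflTransGen.tail hva hab) m hbm h, ham⟩⟩
    exact hj (hside w hvw j hw ((hiff w hvw).mp ((hiff u hvu).mpr ⟨i, hi, hu⟩)))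
  · intro v hv
    obtain ⟨i, hi⟩ := hcov v
    exact ⟨i, Finset.mem_filter.mpr ⟨hv, v, hi, Relation.ReflTransGen.refl⟩⟩
  · rintro v w ⟨-, hv, hw, h | ⟨u, hu, hvu, hwu⟩⟩
    · obtain ⟨i, hvi, hwi⟩ := hG v w h
      exact ⟨i, Finset.mem_filter.mpr ⟨hv, v, hvi, Relation.ReflTransGen.refl⟩,
        Finset.mem_filter.mpr ⟨hw, w, hwi, Relation.ReflTransGen.refl⟩⟩
    · obtain ⟨i, hi⟩ := hcov u
      exact ⟨i, Finset.mem_filter.mpr ⟨hv, u, hi, hvu⟩, Finset.mem_filter.mpr ⟨hw, u, hi, hwu⟩⟩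
  · intro i
    have hsub : bag' i ⊆ (bag i ∩ (X ∪ W)).biUnion
        fun u => X.filter fun v => ReachesThrough G W v u := by
      intro v hv
      simp only [bag', Finset.mem_filter] at hv
      obtain ⟨hvX, u, hu, hvu⟩ := hv
      simp only [Finset.mem_biUnion, Finset.mem_inter, Finset.mem_filter, Finset.mem_union]
      refine ⟨u, ⟨hu, ?_⟩, hvX, hvu⟩
      rcases hvu.eq_or_mem with rfl | h
      exacts [Or.inl hvX, Or.inr h]
    refine (Finset.card_le_card hsub).trans ((Finset.card_biUnion_le_card_mul _ _ (c * D)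
      fun u _ => ?_).trans (Nat.mul_le_mul_right _ (hbag i)))
    by_cases hu : u ∈ W
    · exact card_filter_reachesThrough_to_le hdeg hXW hW hu
    · refine le_trans (Finset.card_le_one.mpr ?_) hcD
      intro a ha b hb
      rw [Finset.mem_filter] at ha hb
      rw [ha.2.eq_or_mem.resolve_right hu, hb.2.eq_or_mem.resolve_right hu]

/-- If `G[W]` has small components and `G[X ∪ W]` has bounded treewidth, then `X` has a 2-coloring
such that the union of `W` and each of the color classes induces small components. -/
theorem exists_coloring_extending {ι : Type*} [Finite ι] {p : ι → ι} {r : ι} {d : ι → ℕ}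
    (hd : ∀ z, z ≠ r → d (p z) < d z) (hr : p r = r) {bag : ι → Finset V}
    (hcut : CutConnected p bag) (hcov : ∀ v, ∃ i, v ∈ bag i)
    (hG : ∀ u v, G.Adj u v → ∃ i, u ∈ bag i ∧ v ∈ bag i) {k : ℕ} (hk : 1 ≤ k)
    (hbag : ∀ i, (bag i ∩ (X ∪ W)).card ≤ k)
    (hdeg : ∀ v, (Finset.univ.filter (G.Adj v)).card ≤ D) (hXW : Disjoint X W)
    (hW : SmallComponents G W c) (hc : 1 ≤ c) (hD : 1 ≤ D) :
    ∃ b : V → Bool, ∀ β,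
      SmallComponents G (X.filter fun v => b v = β) (56 * k * c ^ 2 * D ^ 3) ∧
      SmallComponents G ((X.filter fun v => b v = β) ∪ W) (112 * k * c ^ 3 * D ^ 4) := by
  classical
  -- The auxiliary graph has separators of order `k * (c * D)` and degree at most `2 * c * D * D`.
  obtain ⟨b, hb⟩ := exists_coloring_of_hasSeparations (G := throughGraph G X W) (U := X)
    (k := k * (c * D)) (D := 2 * c * D * D) (Nat.mul_pos hk (Nat.mul_pos hc hD))
    (Nat.mul_pos (Nat.mul_pos (Nat.mul_pos two_pos hc) hD) hD)
    (hasSeparations_throughGraph hd hr hcut hcov hG hk hbag hdeg hXW hW hc hD)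
    (fun v => card_throughGraph_neighbors_le hdeg hXW hW hc hD v)
  have hs : 28 * (k * (c * D)) * (2 * c * D * D) = 56 * k * c ^ 2 * D ^ 3 := by ring
  rw [hs] at hb
  have hpos : 1 ≤ k * c ^ 2 * D ^ 3 :=
    Nat.mul_pos (Nat.mul_pos hk (Nat.pow_pos hc)) (Nat.pow_pos hD)
  refine ⟨b, fun β => ⟨?_, ?_⟩⟩
  · intro v hv
    rw [Finset.mem_filter] at hv
    obtain ⟨K, hvK, hK, hcl⟩ := hb v hv.1
    refine ⟨K ∩ X.filter fun v => b v = β, by simp [hvK, hv],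
      (Finset.card_le_card Finset.inter_subset_left).trans hK, ?_⟩
    intro x hx y hy hxy
    simp only [Finset.mem_inter, Finset.mem_filter] at hx hy ⊢
    exact ⟨hcl x hx.1 y hy.1 ⟨hxy.ne, hx.2.1, hy.1, Or.inl hxy⟩ (hx.2.2.trans hy.2.symm), hy⟩
  have htarget : ∀ v ∈ X, b v = β → ∃ K : Finset V, (v ∈ K ∧ ∀ u ∈ W, ReachesThrough G W v u →
      u ∈ K) ∧ K.card ≤ 112 * k * c ^ 3 * D ^ 4 ∧
      ∀ x ∈ K, ∀ y ∈ (X.filter fun v => b v = β) ∪ W, G.Adj x y → y ∈ K := by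
    intro v hvX hvβ
    obtain ⟨K₀, hvK, hK, hcl⟩ := hb v hvX
    -- To a monochromatic set of the auxiliary graph the components of `W` reached from it are
    -- added, at most `D * c` vertices for each of its members.
    let K₁ := K₀ ∩ X.filter fun v => b v = β
    have hK₁ : K₁.card ≤ 56 * k * c ^ 2 * D ^ 3 :=
      (Finset.card_le_card Finset.inter_subset_left).trans hK
    have hvK₁ : v ∈ K₁ := by simp [K₁, hvK, hvX, hvβ]
    let L := K₁.biUnion fun x => W.filter fun u => ReachesThrough G W x u
    have hL : ∀ {u}, u ∈ L ↔ ∃ x ∈ K₁, u ∈ W ∧ ReachesThrough G W x u := by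
      intro u
      simp [L]
    refine ⟨K₁ ∪ L, ⟨Finset.mem_union_left _ hvK₁, fun u hu hvu =>
      Finset.mem_union_right _ (hL.mpr ⟨v, hvK₁, hu, hvu⟩)⟩, ?_, ?_⟩
    · have h1 : L.card ≤ K₁.card * (D * c) := by
        refine Finset.card_biUnion_le_card_mul _ _ _ fun x hx => ?_
        refine card_filter_reachesThrough_from_le hdeg hW (Finset.disjoint_left.mp hXW ?_)
        simp only [K₁, Finset.mem_inter, Finset.mem_filter] at hx
        exact hx.2.1
      have h2 : K₁.card * 1 ≤ K₁.card * (D * c) := Nat.mul_le_mul_left _ (Nat.mul_pos hD hc)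
      have h3 : K₁.card * (D * c) ≤ 56 * k * c ^ 2 * D ^ 3 * (D * c) :=
        Nat.mul_le_mul_right _ hK₁
      have h4 : 112 * k * c ^ 3 * D ^ 4 = 2 * (56 * k * c ^ 2 * D ^ 3 * (D * c)) := by ring
      have h5 := Finset.card_union_le K₁ L
      omega
    · have hstep : ∀ x ∈ K₁, ∀ u, ReachesThrough G W x u →
          ∀ y ∈ (X.filter fun v => b v = β) ∪ W, G.Adj u y → y ∈ K₁ ∪ L := by
        intro x hx u hxu y hy huy
        have hx' := hx
        simp only [K₁, Finset.mem_inter, Finset.mem_filter] at hx'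
        rcases Finset.mem_union.mp hy with hy | hy
        · rw [Finset.mem_filter] at hy
          refine Finset.mem_union_left _ ?_
          by_cases hne : x = y
          · exact hne ▸ hx
          · simp only [K₁, Finset.mem_inter, Finset.mem_filter]
            refine ⟨hcl x hx'.1 y hy.1 ⟨hne, hx'.2.1, hy.1, ?_⟩
              (hx'.2.2.trans hy.2.symm), hy⟩
            rcases hxu.eq_or_mem with rfl | hu
            · exact Or.inl huy
            · exact Or.inr ⟨u, hu, hxu, Relation.ReflTransGen.single ⟨huy.symm, hu⟩⟩
        · exact Finset.mem_union_right _
            (hL.mpr ⟨x, hx, hy, Relation.ReflTransGen.tail hxu ⟨huy, hy⟩⟩)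
      intro u hu y hy huy
      rcases Finset.mem_union.mp hu with hu | hu
      · exact hstep u hu u Relation.ReflTransGen.refl y hy huy
      · obtain ⟨x, hx, -, hxu⟩ := hL.mp hu
        exact hstep x hx u hxu y hy huy
  intro v hv
  -- Otherwise `v` lies in a component of `G[W]` with no neighbour of color `β` in `X`, which is
  -- already small.
  by_cases hex : ∃ x ∈ X, b x = β ∧ ReachesThrough G W x v
  · obtain ⟨x, hxX, hxβ, hxv⟩ := hex
    obtain ⟨K, hxK, hK⟩ := htarget x hxX hxβ
    refine ⟨K, ?_, hK⟩
    rcases hxv.eq_or_mem with rfl | h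
    exacts [hxK.1, hxK.2 v h hxv]
  · have hvW : v ∈ W := by
      rcases Finset.mem_union.mp hv with h | h
      · rw [Finset.mem_filter] at h
        exact absurd ⟨v, h.1, h.2, Relation.ReflTransGen.refl⟩ hex
      · exact h
    obtain ⟨K, hvK, hK, hcl⟩ := hW v hvW
    refine ⟨K.filter fun u => ReachesThrough G W v u,
      Finset.mem_filter.mpr ⟨hvK, Relation.ReflTransGen.refl⟩, ?_, ?_⟩
    · refine (Finset.card_filter_le _ _).trans (hK.trans ?_)
      calc c = 1 * c * 1 := by ring
        _ ≤ (k * c ^ 2 * D ^ 3) * c * D := Nat.mul_le_mul (Nat.mul_le_mul_right _ hpos) hD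
        _ ≤ 112 * ((k * c ^ 2 * D ^ 3) * c * D) := Nat.le_mul_of_pos_left _ (by norm_num)
        _ = _ := by ring
    · intro x hx y hy hxy
      rw [Finset.mem_filter] at hx
      rcases Finset.mem_union.mp hy with hy | hy
      · rw [Finset.mem_filter] at hy
        have hxW : x ∈ W := by
          rcases hx.2.eq_or_mem with rfl | h
          exacts [hvW, h]
        exact absurd ⟨y, hy.1, hy.2, Relation.ReflTransGen.head ⟨hxy.symm, hxW⟩
          (hx.2.symm hvW)⟩ hex
      · exact Finset.mem_filter.mpr ⟨hcl x hx.1 y hy hxy,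
          Relation.ReflTransGen.tail hx.2 ⟨hxy, hy⟩⟩

end Extension

/-! ### Graphs of bounded layered treewidth -/

/-- `G` has a tree-decomposition over a finite tree, with possibly empty bags, and a layering
indexed by the integers such that each bag meets each layer in at most `w` vertices. -/
def HasIntLayeredDecomposition {V : Type u} (G : SimpleGraph V) (w : ℕ) : Prop :=
  ∃ (ι : Type) (_ : Finite ι) (T : SimpleGraph ι) (bag : ι → Set V) (idx : V → ℤ),
    T.IsTree ∧ (∀ v, (T.induce {x | v ∈ bag x}).Connected) ∧
    (∀ u v, G.Adj u v → ∃ x, u ∈ bag x ∧ v ∈ bag x) ∧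
    (∀ u v, G.Adj u v → |idx u - idx v| ≤ 1) ∧
    ∀ x i, (bag x ∩ {v | idx v = i}).encard ≤ w

theorem hasClustering_of_closed {V : Type u} {G : SimpleGraph V} {k η : ℕ} {c : V → Fin k}
    (h : ∀ v, ∃ K : Finset V, v ∈ K ∧ K.card ≤ η ∧
      ∀ x ∈ K, ∀ y, G.Adj x y → c x = c y → y ∈ K) : HasClustering G c η := by
  intro i K
  obtain ⟨v, rfl⟩ := K.exists_rep
  obtain ⟨K, hvK, hK, hcl⟩ := h v
  have hsub : ∀ u, (G.induce {v | c v = i}).Reachable v u → (u : V) ∈ K := by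
    intro u hu
    rw [SimpleGraph.reachable_iff_reflTransGen] at hu
    induction hu with
    | refl => exact hvK
    | @tail a b _ hab ih =>
      have ha : c a = i := a.2
      have hb : c b = i := b.2
      exact hcl _ ih _ hab (ha.trans hb.symm)
  have himg : Subtype.val '' ((G.induce {v | c v = i}).connectedComponentMk v).supp ⊆
      (K : Set V) := by
    rintro _ ⟨u, hu, rfl⟩
    exact hsub u (SimpleGraph.ConnectedComponent.exact hu).symm
  calc _ = (Subtype.val '' ((G.induce {v | c v = i}).connectedComponentMk v).supp).encard :=
        (Subtype.val_injective.encard_image _).symm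
    _ ≤ (K : Set V).encard := Set.encard_le_encard himg
    _ = K.card := Set.encard_coe_eq_coe_finsetCard K
    _ ≤ η := by exact_mod_cast hK

theorem SmallComponents.union {V : Type*} [DecidableEq V] {G : SimpleGraph V} {U U' : Finset V}
    {M : ℕ} (h : SmallComponents G U M) (h' : SmallComponents G U' M)
    (hadj : ∀ x ∈ U, ∀ y ∈ U', ¬ G.Adj x y) : SmallComponents G (U ∪ U') M := by
  intro v hv
  rcases Finset.mem_union.mp hv with hv | hv
  · obtain ⟨K, hvK, hK, hcl⟩ := h v hv
    refine ⟨K ∩ U, Finset.mem_inter.mpr ⟨hvK, hv⟩,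
      (Finset.card_le_card Finset.inter_subset_left).trans hK, fun x hx y hy hxy => ?_⟩
    rw [Finset.mem_inter] at hx ⊢
    rcases Finset.mem_union.mp hy with hy | hy
    · exact ⟨hcl x hx.1 y hy hxy, hy⟩
    · exact absurd hxy (hadj x hx.2 y hy)
  · obtain ⟨K, hvK, hK, hcl⟩ := h' v hv
    refine ⟨K ∩ U', Finset.mem_inter.mpr ⟨hvK, hv⟩,
      (Finset.card_le_card Finset.inter_subset_left).trans hK, fun x hx y hy hxy => ?_⟩
    rw [Finset.mem_inter] at hx ⊢
    rcases Finset.mem_union.mp hy with hy | hy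
    · exact absurd hxy.symm (hadj y hy x hx.2)
    · exact ⟨hcl x hx.1 y hy hxy, hy⟩

/-- In a graph with a layered decomposition, the vertices of a layer have a 2-coloring that
extends to a given set in the two adjacent layers. -/
theorem HasIntLayeredDecomposition.exists_layer_coloring {V : Type u} [Fintype V] [DecidableEq V]
    {G : SimpleGraph V} [DecidableRel G.Adj] {w D : ℕ} (h : HasIntLayeredDecomposition G w)
    (hw : 1 ≤ w) (hD : 1 ≤ D) (hdeg : ∀ v, (Finset.univ.filter (G.Adj v)).card ≤ D) :
    ∃ idx : V → ℤ, (∀ u v, G.Adj u v → |idx u - idx v| ≤ 1) ∧ ∀ (i : ℤ) (W : Finset V) (c : ℕ),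
      1 ≤ c → (∀ v ∈ W, idx v = i - 1 ∨ idx v = i + 1) → SmallComponents G W c →
      ∃ b : V → Bool, ∀ β,
        SmallComponents G ((Finset.univ.filter fun v => idx v = i).filter fun v => b v = β)
          (168 * w * c ^ 2 * D ^ 3) ∧
        SmallComponents G (((Finset.univ.filter fun v => idx v = i).filter fun v => b v = β) ∪ W)
          (336 * w * c ^ 3 * D ^ 4) := by
  classical
  obtain ⟨ι, _, T, bag, idx, hT, hconn, hG, hidx, hbag⟩ := h
  refine ⟨idx, hidx, fun i W c hc hWi hW => ?_⟩
  obtain ⟨r⟩ := hT.connected.nonempty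
  obtain ⟨p, hpr, hd, hp⟩ := hT.exists_parent r
  have hcut : CutConnected p fun x => (bag x).toFinset := by
    intro v y i j hi hj hvi hvj
    simp only [Set.mem_toFinset] at hvi hvj ⊢
    exact mem_parent_of_connected hp (hconn v).preconnected hi hj hvi hvj
  have hlayer : ∀ x j, ((bag x).toFinset ∩ Finset.univ.filter fun v => idx v = j).card ≤ w := by
    intro x j
    have h := hbag x j
    have heq : bag x ∩ {v | idx v = j} =
        (((bag x).toFinset ∩ Finset.univ.filter fun v => idx v = j : Finset V) : Set V) := by
      ext v
      simp
    rw [heq, Set.encard_coe_eq_coe_finsetCard] at h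
    exact_mod_cast h
  -- The factor 3 in `k` arises because `X ∪ W` lies in three layers.
  obtain ⟨b, hb⟩ := exists_coloring_extending (G := G) (D := D) (c := c)
    (X := Finset.univ.filter fun v => idx v = i) (W := W) (k := 3 * w) hd hpr hcut
    (fun v => by
      obtain ⟨x⟩ := (hconn v).nonempty
      exact ⟨x, Set.mem_toFinset.mpr x.2⟩)
    (fun u v huv => by simpa using hG u v huv) (by omega)
    (fun x => by
      have hsub : (bag x).toFinset ∩ ((Finset.univ.filter fun v => idx v = i) ∪ W) ⊆
          ((bag x).toFinset ∩ Finset.univ.filter fun v => idx v = i) ∪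
          ((bag x).toFinset ∩ Finset.univ.filter fun v => idx v = i - 1) ∪
          ((bag x).toFinset ∩ Finset.univ.filter fun v => idx v = i + 1) := by
        intro v hv
        have := hWi v
        simp only [Finset.mem_inter, Finset.mem_union, Finset.mem_filter, Finset.mem_univ,
          true_and] at hv ⊢
        tauto
      have h1 := (Finset.card_le_card hsub).trans (Finset.card_union_le _ _)
      have h2 := Finset.card_union_le
        ((bag x).toFinset ∩ Finset.univ.filter fun v => idx v = i)
        ((bag x).toFinset ∩ Finset.univ.filter fun v => idx v = i - 1)
      have h3 := hlayer x i
      have h4 := hlayer x (i - 1)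
      have h5 := hlayer x (i + 1)
      omega)
    hdeg
    (by
      rw [Finset.disjoint_left]
      intro v hv hvW
      simp only [Finset.mem_filter, Finset.mem_univ, true_and] at hv
      have := hWi v hvW
      omega)
    hW hc hD
  have h1 : 56 * (3 * w) * c ^ 2 * D ^ 3 = 168 * w * c ^ 2 * D ^ 3 := by ring
  have h2 : 112 * (3 * w) * c ^ 3 * D ^ 4 = 336 * w * c ^ 3 * D ^ 4 := by ring
  rw [h1, h2] at hb
  exact ⟨b, hb⟩

theorem HasIntLayeredDecomposition.colorableWithClustering {V : Type u} [Fintype V]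
    {G : SimpleGraph V} [DecidableRel G.Adj] {w D : ℕ} (h : HasIntLayeredDecomposition G w)
    (hw : 1 ≤ w) (hD : 1 ≤ D) (hdeg : G.maxDegree ≤ D) :
    ColorableWithClustering G 3 (336 * 168 ^ 9 * w ^ 10 * D ^ 31) := by
  classical
  have hdeg' : ∀ v, (Finset.univ.filter (G.Adj v)).card ≤ D := by
    intro v
    rw [← G.neighborFinset_eq_filter, G.card_neighborFinset_eq_degree]
    exact (G.degree_le_maxDegree v).trans hdeg
  obtain ⟨idx, hidx, hext⟩ := h.exists_layer_coloring hw hD hdeg'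
  let layer : ℤ → Finset V := fun i => Finset.univ.filter fun v => idx v = i
  let s₁ := 168 * w * 1 ^ 2 * D ^ 3
  let s₂ := 168 * w * s₁ ^ 2 * D ^ 3
  have hs₁ : 1 ≤ s₁ := Nat.mul_pos (Nat.mul_pos (by omega) (by norm_num)) (Nat.pow_pos hD)
  have hs₂ : s₁ ≤ s₂ := by
    have : 1 ≤ 168 * w * D ^ 3 := Nat.mul_pos (by omega) (Nat.pow_pos hD)
    calc s₁ = s₁ * 1 * 1 := by ring
      _ ≤ s₁ * s₁ * (168 * w * D ^ 3) :=
        Nat.mul_le_mul (Nat.mul_le_mul_left _ hs₁) this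
      _ = s₂ := by simp only [s₂]; ring
  have hM₂ : 336 * w * s₂ ^ 3 * D ^ 4 = 336 * 168 ^ 9 * w ^ 10 * D ^ 31 := by
    simp only [s₂, s₁]
    ring
  have hM₁ : 336 * w * s₁ ^ 3 * D ^ 4 ≤ 336 * w * s₂ ^ 3 * D ^ 4 :=
    Nat.mul_le_mul_right _ (Nat.mul_le_mul_left _ (Nat.pow_le_pow_left hs₂ 3))
  -- The functions `b₀`, `b₁`, `b₂` will be used on layers of residue 0, 1, 2. Each extends the
  -- classes of the earlier colorings that share a color with it: none for `b₀`, the layer below for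
  -- `b₁`, both adjacent layers for `b₂`.
  choose b₀ hb₀ using fun i => hext i ∅ 1 le_rfl (by simp) (by simp [SmallComponents])
  choose b₁ hb₁ using fun i => hext i ((layer (i - 1)).filter fun v => b₀ (i - 1) v = true) s₁ hs₁
    (fun v hv => by
      simp only [layer, Finset.mem_filter, Finset.mem_univ, true_and] at hv
      exact Or.inl hv.1)
    (hb₀ (i - 1) true).1
  choose b₂ hb₂ using fun i => hext i
    (((layer (i - 1)).filter fun v => b₁ (i - 1) v = true) ∪
      ((layer (i + 1)).filter fun v => b₀ (i + 1) v = false)) s₂ (hs₁.trans hs₂)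
    (fun v hv => by
      simp only [layer, Finset.mem_union, Finset.mem_filter, Finset.mem_univ, true_and] at hv
      tauto)
    ((hb₁ (i - 1) true).1.union ((hb₀ (i + 1) false).1.mono subset_rfl hs₂) (by
      intro x hx y hy hxy
      simp only [layer, Finset.mem_filter, Finset.mem_univ, true_and] at hx hy
      have := abs_le.mp (hidx x y hxy)
      omega))
  let c : V → Fin 3 := fun v =>
    if idx v % 3 = 0 then (if b₀ (idx v) v then 1 else 0)
    else if idx v % 3 = 1 then (if b₁ (idx v) v then 2 else 1)
    else (if b₂ (idx v) v then 0 else 2)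
  have hc₀ : ∀ {v l}, idx v = l → l % 3 = 0 → c v = if b₀ l v then 1 else 0 := by
    rintro v l rfl hl
    simp only [c, if_pos hl]
  have hc₁ : ∀ {v l}, idx v = l → l % 3 = 1 → c v = if b₁ l v then 2 else 1 := by
    rintro v l rfl hl
    simp only [c, hl, one_ne_zero, if_false, if_true]
  have hc₂ : ∀ {v l}, idx v = l → l % 3 = 2 → c v = if b₂ l v then 0 else 2 := by
    rintro v l rfl hl
    simp only [c, hl, OfNat.ofNat_ne_zero, OfNat.ofNat_ne_one, if_false]
  -- Color `a` is not used on layers of residue `a + 1`, so its components lie in layers `l` and `l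
  -- + 1` with `l` of residue `a + 2`.
  have hres : ∀ v, idx v % 3 ≠ (((c v : Fin 3) : ℕ) + 1) % 3 := by
    intro v
    simp only [c]
    split_ifs <;> simp <;> omega
  have hlay : ∀ v, ∃ l : ℤ, l % 3 = (((c v : Fin 3) : ℕ) + 2) % 3 ∧
      (idx v = l ∨ idx v = l + 1) := by
    intro v
    have h1 := hres v
    by_cases h2 : idx v % 3 = (((c v : Fin 3) : ℕ) + 2) % 3
    · exact ⟨idx v, h2, Or.inl rfl⟩
    · exact ⟨idx v - 1, by omega, Or.inr (by omega)⟩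
  have hsmall : ∀ (a : Fin 3) (l : ℤ), l % 3 = ((a : ℕ) + 2) % 3 →
      SmallComponents G (Finset.univ.filter fun v => c v = a ∧ (idx v = l ∨ idx v = l + 1))
        (336 * w * s₂ ^ 3 * D ^ 4) := by
    intro a l hl
    fin_cases a
    · have hl : l % 3 = 2 := by simpa using hl
      refine (hb₂ l true).2.mono ?_ le_rfl
      intro v hv
      simp only [Finset.mem_filter, Finset.mem_univ, true_and, Finset.mem_union, layer] at hv ⊢
      obtain ⟨hcv, hv | hv⟩ := hv
      · refine Or.inl ⟨hv, ?_⟩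
        by_contra hb
        rw [hc₂ hv hl] at hcv
        simp [hb] at hcv
      · refine Or.inr (Or.inr ⟨hv, ?_⟩)
        have hl' : (l + 1) % 3 = 0 := by omega
        by_contra hb
        rw [hc₀ hv hl'] at hcv
        simp [hb] at hcv
    · have hl : l % 3 = 0 := by simpa using hl
      refine (hb₁ (l + 1) false).2.mono ?_ hM₁
      intro v hv
      simp only [Finset.mem_filter, Finset.mem_univ, true_and, Finset.mem_union, layer,
        add_sub_cancel_right] at hv ⊢
      obtain ⟨hcv, hv | hv⟩ := hv
      · refine Or.inr ⟨hv, ?_⟩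
        by_contra hb
        rw [hc₀ hv hl] at hcv
        simp [hb] at hcv
      · refine Or.inl ⟨hv, ?_⟩
        have hl' : (l + 1) % 3 = 1 := by omega
        by_contra hb
        rw [hc₁ hv hl'] at hcv
        simp [hb] at hcv
    · have hl : l % 3 = 1 := by simpa using hl
      refine (hb₂ (l + 1) false).2.mono ?_ le_rfl
      intro v hv
      simp only [Finset.mem_filter, Finset.mem_univ, true_and, Finset.mem_union, layer,
        add_sub_cancel_right] at hv ⊢
      obtain ⟨hcv, hv | hv⟩ := hv
      · refine Or.inr (Or.inl ⟨hv, ?_⟩)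
        by_contra hb
        rw [hc₁ hv hl] at hcv
        simp [hb] at hcv
      · refine Or.inl ⟨hv, ?_⟩
        have hl' : (l + 1) % 3 = 2 := by omega
        by_contra hb
        rw [hc₂ hv hl'] at hcv
        simp [hb] at hcv
  refine ⟨c, hasClustering_of_closed fun v => ?_⟩
  obtain ⟨l, hl, hvl⟩ := hlay v
  let U := Finset.univ.filter fun x => c x = c v ∧ (idx x = l ∨ idx x = l + 1)
  have hvU : v ∈ U := by simp [U, hvl]
  obtain ⟨K, hvK, hK, hcl⟩ := hsmall (c v) l hl v hvU
  refine ⟨K ∩ U, Finset.mem_inter.mpr ⟨hvK, hvU⟩,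
    (Finset.card_le_card Finset.inter_subset_left).trans (hK.trans hM₂.le), ?_⟩
  intro x hx y hxy hc
  rw [Finset.mem_inter] at hx
  have hxU := hx.2
  simp only [U, Finset.mem_filter, Finset.mem_univ, true_and] at hxU
  have hyU : y ∈ U := by
    simp only [U, Finset.mem_filter, Finset.mem_univ, true_and]
    have hyc : c y = c v := hc.symm.trans hxU.1
    refine ⟨hyc, ?_⟩
    have h1 := hres y
    rw [hyc] at h1
    have h2 := abs_le.mp (hidx x y hxy)
    omega
  exact Finset.mem_inter.mpr ⟨hcl x hx.1 y hyU hxy, hyU⟩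

/-- Ensures that the infimum defining `layeredTreewidth` is attained. -/
theorem hasLayeredTreeDecomposition_card {V : Type u} [Fintype V] [Nonempty V]
    (G : SimpleGraph V) : HasLayeredTreeDecomposition G (Fintype.card V) := by
  refine ⟨Unit, inferInstance, ⊥, ⟨SimpleGraph.IsTree.of_subsingleton, fun _ => Set.univ,
    fun _ => Set.univ_nonempty, fun v => ?_, fun v w _ => ⟨(), trivial, trivial⟩⟩,
    ⟨fun _ => 0, fun v w _ => ⟨0, Or.inl rfl, Or.inl rfl⟩⟩, fun x i => ?_⟩
  · have : Nonempty {x : Unit | v ∈ (fun _ : Unit => (Set.univ : Set V)) x} := ⟨⟨(), trivial⟩⟩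
    exact (SimpleGraph.IsTree.of_subsingleton).connected
  · calc _ ≤ (Set.univ : Set V).encard := Set.encard_le_encard (Set.subset_univ _)
      _ = Fintype.card V := by rw [Set.encard_univ, ENat.card_eq_coe_fintype_card]

theorem hasIntLayeredDecomposition_of_layeredTreewidth_le {V : Type u} [Fintype V] [Nonempty V]
    {G : SimpleGraph V} {w : ℕ} (h : layeredTreewidth G ≤ w) : HasIntLayeredDecomposition G w := by
  obtain ⟨ι, hι, T, D, L, hDL⟩ : HasLayeredTreeDecomposition G (layeredTreewidth G) :=
    Nat.sInf_mem (s := {l | HasLayeredTreeDecomposition G l})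
      ⟨_, hasLayeredTreeDecomposition_card G⟩
  refine ⟨ι, hι, T, D.bag, fun v => L.index v, D.isTree, D.subtree, D.edge_mem, ?_, ?_⟩
  · intro u v huv
    obtain ⟨i, hu, hv⟩ := L.adj u v huv
    change |(L.index u : ℤ) - L.index v| ≤ 1
    rw [abs_le]
    omega
  · intro x i
    refine le_trans (Set.encard_le_encard ?_) ((hDL x i.toNat).trans (by exact_mod_cast h))
    rintro v ⟨hv, hvi⟩
    refine ⟨hv, ?_⟩
    change L.index v = i.toNat
    change (L.index v : ℤ) = i at hvi
    omega

/-! ### Radial graphs of cellular surfaces -/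

theorem even_card_of_involution {α : Type*} [DecidableEq α] (C : Finset α) (s : α → α)
    (hmem : ∀ a ∈ C, s a ∈ C) (hne : ∀ a, s a ≠ a) (hs : ∀ a, s (s a) = a) : Even C.card := by
  have h : ∑ _a ∈ C, (1 : ZMod 2) = 0 :=
    Finset.sum_involution (fun a _ => s a) (fun _ _ => by decide) (fun a _ _ => hne a)
      (fun a ha => hmem a ha) (fun a _ => hs a)
  rw [Finset.sum_const, nsmul_eq_mul, mul_one] at h
  exact (ZMod.natCast_eq_zero_iff_even).mp h

/-- Around a cycle formed by two perfect matchings, a predicate that is constant along all edges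
but one is constant along the remaining edge as well. -/
theorem iff_of_involutions {α : Type*} [Finite α] {s t : α → α} (hs : ∀ a, s (s a) = a)
    (hs' : ∀ a, s a ≠ a) (ht : ∀ a, t (t a) = a) (ht' : ∀ a, t a ≠ a) {F P : α → Prop}
    (hFs : ∀ a, F a → F (s a)) (hFt : ∀ a, F a → F (t a)) (hPt : ∀ a, F a → (P (t a) ↔ P a))
    {e : α} (he : F e) (hPs : ∀ a, F a → a ≠ e → a ≠ s e → (P (s a) ↔ P a)) :
    P (s e) ↔ P e := by
  classical
  have := Fintype.ofFinite α
  by_contra hcon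
  -- If `P` differed at `s e`, then `t` would pair up `C` while `s` would pair up `C` without `e`,
  -- so two consecutive cardinalities would be even.
  let C := Finset.univ.filter fun a => F a ∧ (P a ↔ P e)
  have hC : ∀ {a}, a ∈ C ↔ F a ∧ (P a ↔ P e) := by simp [C]
  have h1 : Even C.card := even_card_of_involution C t
    (fun a ha => hC.mpr ⟨hFt a (hC.mp ha).1, (hPt a (hC.mp ha).1).trans (hC.mp ha).2⟩) ht' ht
  have heC : e ∈ C := hC.mpr ⟨he, Iff.rfl⟩
  have h2 : Even (C.erase e).card := even_card_of_involution (C.erase e) s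
    (fun a ha => by
      rw [Finset.mem_erase, hC] at ha
      have hse : a ≠ s e := by
        rintro rfl
        exact hcon ha.2.2
      rw [Finset.mem_erase, hC]
      exact ⟨fun h => hse (by rw [← h, hs]), hFs a ha.2.1,
        (hPs a ha.2.1 ha.1 hse).trans ha.2.2⟩) hs' hs
  have h3 := Finset.card_erase_add_one heC
  rw [← h3] at h1
  exact (Nat.even_add_one.mp h1) h2

namespace CellularSurface

variable {Φ : Type} (M : CellularSurface Φ)

theorem cell_swap {i k : Fin 3} (h : i ≠ k) (a : Φ) : M.cell k (M.swap i a) = M.cell k a :=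
  (Quot.sound ⟨i, h, rfl⟩).symm

theorem exists_cell_eq {k : Fin 3} (c : M.Cell k) : ∃ a, M.cell k a = c := Quot.exists_rep c

theorem finite_cell (k : Fin 3) : Finite (M.Cell k) := by
  have := M.finite
  exact Finite.of_surjective (M.cell k) fun c => M.exists_cell_eq c

variable {M} in
theorem iff_of_cell_eq {k : Fin 3} {c : M.Cell k} {P : Φ → Prop}
    (hP : ∀ i a, i ≠ k → M.cell k a = c → (P (M.swap i a) ↔ P a)) {a b : Φ}
    (ha : M.cell k a = c) (hb : M.cell k b = c) : P a ↔ P b := by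
  let f : M.Cell k → Prop := Quot.lift (fun a => M.cell k a = c → P a) (by
    rintro a _ ⟨i, hi, rfl⟩
    refine propext ?_
    rw [M.cell_swap hi]
    exact forall_congr' fun h => (hP i a hi h).symm)
  have hf : ∀ a, f (M.cell k a) = (M.cell k a = c → P a) := fun a => rfl
  have h : (M.cell k a = c → P a) = (M.cell k b = c → P b) := by
    rw [← hf, ← hf, ha, hb]
  simpa [ha, hb] using h

/-- The nodes of the radial graph: the vertices and the faces of the surface. -/
abbrev RadialNode : Type := M.Cell 0 ⊕ M.Cell 2

/-- The flag `a` has a corner at the node `z`. -/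
def Touches (a : Φ) (z : M.RadialNode) : Prop :=
  Sum.inl (M.cell 0 a) = z ∨ Sum.inr (M.cell 2 a) = z

theorem touches_swap_one {a : Φ} {z : M.RadialNode} : M.Touches (M.swap 1 a) z ↔ M.Touches a z := by
  rw [Touches, Touches, M.cell_swap (by decide), M.cell_swap (by decide)]

/-- The graph in which each vertex is adjacent to the faces incident with it. -/
def radialGraph : SimpleGraph M.RadialNode where
  Adj x y := x ≠ y ∧ ∃ a, M.Touches a x ∧ M.Touches a y
  symm := by
    constructor
    rintro x y ⟨h, a, hx, hy⟩
    exact ⟨h.symm, a, hy, hx⟩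
  loopless := by
    constructor
    intro x h
    exact h.1 rfl

variable {M} in
theorem Touches.eq_or_eq {a : Φ} {x y z : M.RadialNode} (hxy : x ≠ y) (hx : M.Touches a x)
    (hy : M.Touches a y) (hz : M.Touches a z) : z = x ∨ z = y := by
  rcases hx with rfl | rfl <;> rcases hy with rfl | rfl <;> rcases hz with rfl | rfl <;> simp_all

theorem radialGraph_connected : M.radialGraph.Connected := by
  have hadj : ∀ a, M.radialGraph.Adj (Sum.inl (M.cell 0 a)) (Sum.inr (M.cell 2 a)) := fun a =>
    ⟨by simp, a, Or.inl rfl, Or.inr rfl⟩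
  obtain ⟨a₀⟩ := M.nonempty
  have hreach : ∀ a, M.radialGraph.Reachable (Sum.inl (M.cell 0 a₀)) (Sum.inl (M.cell 0 a)) := by
    intro a
    induction M.connected a₀ a with
    | refl => exact SimpleGraph.Reachable.refl _
    | @tail b _ _ hb ih =>
      obtain ⟨i, rfl⟩ := hb
      by_cases hi : i = 0
      · subst hi
        refine ih.trans ((hadj b).reachable.trans ?_)
        have h := (hadj (M.swap 0 b)).symm.reachable
        rwa [M.cell_swap (k := 2) (by decide)] at h
      · rwa [M.cell_swap hi]
  rw [SimpleGraph.connected_iff_exists_forall_reachable]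
  refine ⟨Sum.inl (M.cell 0 a₀), ?_⟩
  rintro (c | c)
  · obtain ⟨a, rfl⟩ := M.exists_cell_eq c
    exact hreach a
  · obtain ⟨a, rfl⟩ := M.exists_cell_eq c
    exact (hreach a).trans (hadj a).reachable

/-- A spanning tree of the radial graph, given by its parent function, the depths of the nodes and,
for every node other than the root, a flag at the edge to its parent. -/
structure RadialTree where
  root : M.RadialNode
  parent : M.RadialNode → M.RadialNode
  depth : M.RadialNode → ℕ
  flag : M.RadialNode → Φ
  parent_root : parent root = root
  depth_eq_zero : ∀ z, depth z = 0 ↔ z = root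
  depth_parent : ∀ z, z ≠ root → depth (parent z) + 1 = depth z
  touches_flag : ∀ z, z ≠ root → M.Touches (flag z) z
  touches_flag_parent : ∀ z, z ≠ root → M.Touches (flag z) (parent z)
  depth_le : ∀ a x y, M.Touches a x → M.Touches a y → depth x ≤ depth y + 1

theorem nonempty_radialTree : Nonempty M.RadialTree := by
  have hconn := M.radialGraph_connected
  obtain ⟨r⟩ := hconn.nonempty
  obtain ⟨p, hpr, hp⟩ := hconn.exists_parent r
  have hflag : ∀ z, ∃ a, z ≠ r → M.Touches a z ∧ M.Touches a (p z) := by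
    intro z
    by_cases hz : z = r
    · obtain ⟨a⟩ := M.nonempty
      exact ⟨a, fun h => absurd hz h⟩
    · obtain ⟨-, a, ha⟩ := (hp z hz).1
      exact ⟨a, fun _ => ha⟩
  choose t ht using hflag
  refine ⟨⟨r, p, M.radialGraph.dist r, t, hpr, ?_, fun z hz => (hp z hz).2,
    fun z hz => (ht z hz).1, fun z hz => (ht z hz).2, ?_⟩⟩
  · intro z
    rw [hconn.dist_eq_zero_iff, eq_comm]
  · intro a x y hx hy
    by_cases hxy : x = y
    · subst hxy
      omega
    · have h1 : M.radialGraph.dist r x ≤ M.radialGraph.dist r y + M.radialGraph.dist y x :=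
        hconn.dist_triangle
      have h2 : M.radialGraph.dist y x = 1 :=
        SimpleGraph.dist_eq_one_iff_adj.mpr ⟨fun h => hxy h.symm, a, hy, hx⟩
      omega

namespace RadialTree

variable {M} (R : M.RadialTree)

/-- The flags at the edges of the tree. -/
def IsTreeFlag (a : Φ) : Prop :=
  ∃ z : {z // z ≠ R.root}, a = R.flag z ∨ a = M.swap 1 (R.flag z)

theorem isTreeFlag_swap_one {a : Φ} : R.IsTreeFlag (M.swap 1 a) ↔ R.IsTreeFlag a := by
  have h : ∀ a, R.IsTreeFlag a → R.IsTreeFlag (M.swap 1 a) := by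
    rintro a ⟨z, rfl | rfl⟩
    · exact ⟨z, Or.inr rfl⟩
    · exact ⟨z, Or.inl (M.swap_swap _ _)⟩
  refine ⟨fun h' => ?_, h a⟩
  have := h _ h'
  rwa [M.swap_swap] at this

theorem ne_parent {z : M.RadialNode} (hz : z ≠ R.root) : z ≠ R.parent z := by
  intro h
  have := R.depth_parent z hz
  rw [← h] at this
  omega

/-- The flag `a` has a corner at a descendant of `z`. -/
def TouchesBelow (a : Φ) (z : M.RadialNode) : Prop :=
  ∃ y ∈ descendants R.parent z, M.Touches a y

theorem touchesBelow_swap_one {a : Φ} {z : M.RadialNode} :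
    R.TouchesBelow (M.swap 1 a) z ↔ R.TouchesBelow a z := by
  simp only [TouchesBelow, M.touches_swap_one]

theorem touchesBelow_root (a : Φ) : R.TouchesBelow a R.root :=
  ⟨_, descendants_root (d := R.depth) (fun z hz => by have := R.depth_parent z hz; omega) _,
    Or.inl rfl⟩

/-- A predicate that is invariant under the adjacencies of flags that keep the node, except under
those across the edge from `z` to its parent, is constant on the flags at `z`. -/
theorem iff_of_touches {P : Φ → Prop} (h0 : ∀ a, P (M.swap 0 a) ↔ P a)
    (h2 : ∀ a, P (M.swap 2 a) ↔ P a) {z : M.RadialNode}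
    (h1 : ∀ a, M.Touches a z → (z ≠ R.root → a ≠ R.flag z ∧ a ≠ M.swap 1 (R.flag z)) →
      (P (M.swap 1 a) ↔ P a)) {a b : Φ} (ha : M.Touches a z) (hb : M.Touches b z) :
    P a ↔ P b := by
  have := M.finite
  -- The flags at `z` form a cycle under `swap 1` and `swap t`, with `t = 2` at a vertex and `t = 0`
  -- at a face. The edge to the parent is one step of this cycle, the only one not covered by the
  -- hypothesis.
  have hcross : ∀ t : Fin 3, (∀ a, P (M.swap t a) ↔ P a) →
      (∀ a, M.Touches a z → M.Touches (M.swap t a) z) →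
      ∀ a, M.Touches a z → (P (M.swap 1 a) ↔ P a) := by
    intro t hPt hFt a ha
    by_cases hz : z = R.root
    · exact h1 a ha fun h => absurd hz h
    · have hmain : P (M.swap 1 (R.flag z)) ↔ P (R.flag z) :=
        iff_of_involutions (M.swap_swap 1) (M.swap_ne 1) (M.swap_swap t) (M.swap_ne t)
          (F := fun a => M.Touches a z) (fun a => M.touches_swap_one.mpr) hFt
          (fun a _ => hPt a) (R.touches_flag z hz) fun a ha h h' => h1 a ha fun _ => ⟨h, h'⟩
      by_cases h : a = R.flag z
      · rwa [h]
      · by_cases h' : a = M.swap 1 (R.flag z)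
        · rw [h', M.swap_swap]
          exact hmain.symm
        · exact h1 a ha fun _ => ⟨h, h'⟩
  rcases z with c | c
  · have hT : ∀ a, M.Touches a (Sum.inl c) ↔ M.cell 0 a = c := by simp [Touches]
    have hcross := hcross 2 h2 fun a ha => by
      rw [hT, M.cell_swap (by decide)]
      exact (hT a).mp ha
    refine iff_of_cell_eq (c := c) (fun i a hi ha => ?_) ((hT a).mp ha) ((hT b).mp hb)
    obtain rfl | rfl | rfl : i = 0 ∨ i = 1 ∨ i = 2 := by omega
    exacts [absurd rfl hi, hcross a ((hT a).mpr ha), h2 a]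
  · have hT : ∀ a, M.Touches a (Sum.inr c) ↔ M.cell 2 a = c := by simp [Touches]
    have hcross := hcross 0 h0 fun a ha => by
      rw [hT, M.cell_swap (by decide)]
      exact (hT a).mp ha
    refine iff_of_cell_eq (c := c) (fun i a hi ha => ?_) ((hT a).mp ha) ((hT b).mp hb)
    obtain rfl | rfl | rfl : i = 0 ∨ i = 1 ∨ i = 2 := by omega
    exacts [h0 a, hcross a ((hT a).mpr ha), absurd rfl hi]

/-- The walk around a subtree: a predicate that is constant on every edge of the surface and
invariant under crossing the edges of the radial graph that are not in the tree and have an end in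
the subtree of `z` is constant on the flags that meet this subtree. -/
theorem iff_of_touchesBelow {P : Φ → Prop} (h0 : ∀ a, P (M.swap 0 a) ↔ P a)
    (h2 : ∀ a, P (M.swap 2 a) ↔ P a) {z : M.RadialNode}
    (h1 : ∀ a, ¬ R.IsTreeFlag a → R.TouchesBelow a z → (P (M.swap 1 a) ↔ P a)) {a b : Φ}
    (ha : R.TouchesBelow a z) (hb : R.TouchesBelow b z) : P a ↔ P b := by
  have := M.finite_cell 0
  have := M.finite_cell 2
  obtain ⟨B, hB⟩ : ∃ B, ∀ z, R.depth z ≤ B := by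
    obtain ⟨B, hB⟩ := (Set.finite_range R.depth).bddAbove
    exact ⟨B, fun z => hB ⟨z, rfl⟩⟩
  -- Induction from the deepest nodes towards the root.
  induction hn : B - R.depth z using Nat.strong_induction_on generalizing z a b with
  | _ n ih =>
  have hchild : ∀ y, y ≠ z → R.parent y = z → y ≠ R.root ∧ ∀ a b, R.TouchesBelow a y →
      R.TouchesBelow b y → (P a ↔ P b) := by
    intro y hy hyz
    have hyr : y ≠ R.root := by
      rintro rfl
      exact hy (by rw [← hyz, R.parent_root])
    have hd := R.depth_parent y hyr
    rw [hyz] at hd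
    have hBy := hB y
    refine ⟨hyr, fun a b ha hb => ih (B - R.depth y) (by omega) (z := y) ?_ ha hb rfl⟩
    rintro a ha ⟨x, hx, hax⟩
    exact h1 a ha ⟨x, descendants_trans hyz hx, hax⟩
  -- A tree edge at `z` other than the one to its parent leads to a child; the flags on both sides
  -- of it touch that child, so the induction hypothesis compares them.
  have hnode : ∀ a b, M.Touches a z → M.Touches b z → (P a ↔ P b) := by
    intro a b
    refine R.iff_of_touches h0 h2 fun a ha hne => ?_
    by_cases hTa : R.IsTreeFlag a
    · obtain ⟨⟨y, hyr⟩, hay⟩ := hTa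
      have hflag : ∀ x, M.Touches (R.flag y) x ↔ M.Touches a x := by
        rcases hay with rfl | rfl <;> simp [M.touches_swap_one]
      have hyz : y ≠ z := by
        rintro rfl
        rcases hay with h | h
        exacts [(hne hyr).1 h, (hne hyr).2 h]
      have hpy : R.parent y = z := by
        rcases Touches.eq_or_eq (R.ne_parent hyr) (R.touches_flag y hyr)
          (R.touches_flag_parent y hyr) ((hflag z).mpr ha) with h | h
        exacts [absurd h.symm hyz, h.symm]
      have hy : M.Touches a y := (hflag y).mp (R.touches_flag y hyr)
      exact (hchild y hyz hpy).2 _ _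
        ⟨y, self_mem_descendants _ _, M.touches_swap_one.mpr hy⟩ ⟨y, self_mem_descendants _ _, hy⟩
    · exact h1 a hTa ⟨z, self_mem_descendants _ _, ha⟩
  have hmain : ∀ a, R.TouchesBelow a z → ∃ b, M.Touches b z ∧ (P a ↔ P b) := by
    rintro a ⟨x, hx, hax⟩
    rcases mem_descendants_child hx with rfl | ⟨y, hyz, hpy, hxy⟩
    · exact ⟨a, hax, Iff.rfl⟩
    · obtain ⟨hyr, hy⟩ := hchild y hyz hpy
      exact ⟨R.flag y, hpy ▸ R.touches_flag_parent y hyr, hy _ _ ⟨x, hxy, hax⟩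
        ⟨y, self_mem_descendants _ _, R.touches_flag y hyr⟩⟩
  obtain ⟨a', ha', haa'⟩ := hmain a ha
  obtain ⟨b', hb', hbb'⟩ := hmain b hb
  exact haa'.trans ((hnode a' b' ha' hb').trans hbb'.symm)

end RadialTree

end CellularSurface

/-! ### Layered treewidth of embedded graphs -/

namespace CellularSurface

variable {Φ : Type} (M : CellularSurface Φ)

theorem card_cell_one_fiber_le [Fintype Φ] [DecidableEq Φ] [DecidableEq (M.Cell 1)]
    (c : M.Cell 1) : (Finset.univ.filter fun a => M.cell 1 a = c).card ≤ 4 := by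
  obtain ⟨a, rfl⟩ := M.exists_cell_eq c
  refine (Finset.card_le_card (t := {a, M.swap 0 a, M.swap 2 a, M.swap 0 (M.swap 2 a)}) ?_).trans
    Finset.card_le_four
  intro b hb
  have hP : ∀ i b, i ≠ 1 → b ∈ ({a, M.swap 0 a, M.swap 2 a, M.swap 0 (M.swap 2 a)} : Finset Φ) →
      M.swap i b ∈ ({a, M.swap 0 a, M.swap 2 a, M.swap 0 (M.swap 2 a)} : Finset Φ) := by
    intro i b hi hb
    obtain rfl | rfl : i = 0 ∨ i = 2 := by omega
    · simp only [Finset.mem_insert, Finset.mem_singleton] at hb ⊢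
      rcases hb with rfl | rfl | rfl | rfl <;> simp [M.swap_swap]
    · simp only [Finset.mem_insert, Finset.mem_singleton] at hb ⊢
      rcases hb with rfl | rfl | rfl | rfl
      · simp
      · simp [M.swap_comm]
      · simp [M.swap_swap]
      · simp [← M.swap_comm, M.swap_swap]
  refine (iff_of_cell_eq (k := 1) (c := M.cell 1 a) (P := fun b => b ∈ _) (fun i b hi _ => ⟨?_,
    hP i b hi⟩) rfl (Finset.mem_filter.mp hb).2).mp (Finset.mem_insert_self _ _)
  intro h
  have := hP i _ hi h
  rwa [M.swap_swap] at this

theorem card_flags_le : Nat.card Φ ≤ 4 * Nat.card (M.Cell 1) := by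
  classical
  have := M.finite
  have := M.finite_cell 1
  have := Fintype.ofFinite Φ
  have := Fintype.ofFinite (M.Cell 1)
  rw [Nat.card_eq_fintype_card, Nat.card_eq_fintype_card]
  exact Finset.card_le_mul_card_image_of_maps_to (f := M.cell 1) (fun a _ => Finset.mem_univ _) 4
    fun c _ => M.card_cell_one_fiber_le c

theorem two_mul_card_le {A : Type} [Finite A] (f : A → Φ)
    (hf : ∀ x y, f x = f y ∨ f x = M.swap 1 (f y) → x = y) :
    2 * Nat.card A ≤ {a | ∃ x, a = f x ∨ a = M.swap 1 (f x)}.ncard := by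
  have := M.finite
  let g : A × Bool → Φ := fun x => if x.2 then f x.1 else M.swap 1 (f x.1)
  have hg : Function.Injective g := by
    rintro ⟨x, b⟩ ⟨y, b'⟩ h
    have hswap : ∀ x y, M.swap 1 (f x) = f y → f x = M.swap 1 (f y) := by
      intro x y h
      rw [← h, M.swap_swap]
    cases b <;> cases b' <;> simp only [g, if_true, Bool.false_eq_true, if_false] at h
    · have := congrArg (M.swap 1) h
      rw [M.swap_swap, M.swap_swap] at this
      rw [hf x y (Or.inl this)]
    · obtain rfl := hf x y (Or.inr (hswap x y h))
      exact absurd h (M.swap_ne _ _)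
    · obtain rfl := hf x y (Or.inr h)
      exact absurd h.symm (M.swap_ne _ _)
    · rw [hf x y (Or.inl h)]
  have hsub : g '' Set.univ ⊆ {a | ∃ x, a = f x ∨ a = M.swap 1 (f x)} := by
    rintro _ ⟨⟨x, b⟩, -, rfl⟩
    cases b
    · exact ⟨x, Or.inr rfl⟩
    · exact ⟨x, Or.inl rfl⟩
  have h := Set.ncard_le_ncard hsub (Set.toFinite _)
  rw [Set.ncard_image_of_injective _ hg, Set.ncard_univ, Nat.card_prod, Nat.card_eq_two_iff.mpr
    ⟨false, true, by simp, by ext b; cases b <;> simp⟩] at h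
  omega

namespace RadialTree

variable {M} (R : M.RadialTree)

/-- The tree has one edge fewer than nodes, and each edge carries two flags. A flag shared by two
nodes would make each the parent of the other, contradicting the depths. -/
theorem two_mul_card_nodes_le :
    2 * (Nat.card (M.Cell 0) + Nat.card (M.Cell 2)) ≤ {a | R.IsTreeFlag a}.ncard + 2 := by
  classical
  have := M.finite_cell 0
  have := M.finite_cell 2
  have := Fintype.ofFinite M.RadialNode
  have h := M.two_mul_card_le (A := {z // z ≠ R.root}) (fun z => R.flag z) (by
    rintro ⟨y, hy⟩ ⟨z, hz⟩ h
    have hflag : ∀ x, M.Touches (R.flag y) x ↔ M.Touches (R.flag z) x := by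
      intro x
      rcases h with h | h <;> simp only at h <;> simp only [h, M.touches_swap_one]
    have h1 := Touches.eq_or_eq (R.ne_parent hz) (R.touches_flag z hz)
      (R.touches_flag_parent z hz) ((hflag y).mp (R.touches_flag y hy))
    have h2 := Touches.eq_or_eq (R.ne_parent hy) (R.touches_flag y hy)
      (R.touches_flag_parent y hy) ((hflag z).mpr (R.touches_flag z hz))
    refine Subtype.ext ?_
    rcases h1 with h1 | h1
    · exact h1
    · rcases h2 with h2 | h2
      · exact h2.symm
      · have h3 := R.depth_parent y hy
        have h4 := R.depth_parent z hz
        rw [← h1] at h4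
        rw [← h2] at h3
        omega)
  have hcard : Nat.card {z // z ≠ R.root} + 1 = Nat.card (M.Cell 0) + Nat.card (M.Cell 2) := by
    have hN : Nat.card M.RadialNode = Nat.card (M.Cell 0) + Nat.card (M.Cell 2) := Nat.card_sum
    rw [← hN, Nat.card_eq_fintype_card, Nat.card_eq_fintype_card,
      Fintype.card_subtype_compl, Fintype.card_subtype_eq]
    have := Fintype.card_pos_iff.mpr ⟨R.root⟩
    omega
  change _ ≤ {a | R.IsTreeFlag a}.ncard at h
  omega

/-- The dual of the complement of the tree: two edges of the surface are adjacent if they lie on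
either side of an edge of the radial graph that is not in the tree. -/
def dualGraph : SimpleGraph (M.Cell 1) where
  Adj x y := x ≠ y ∧ ∃ a, ¬ R.IsTreeFlag a ∧ M.cell 1 a = x ∧ M.cell 1 (M.swap 1 a) = y
  symm := by
    constructor
    rintro x y ⟨h, a, ha, hx, hy⟩
    exact ⟨h.symm, M.swap 1 a, fun h => ha (R.isTreeFlag_swap_one.mp h), hy, by rwa [M.swap_swap]⟩
  loopless := by
    constructor
    intro x h
    exact h.1 rfl

/-- Every flag touches a descendant of the root, so the walk around the whole tree meets all edges
of the surface. -/
theorem dualGraph_connected : R.dualGraph.Connected := by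
  obtain ⟨a₀⟩ := M.nonempty
  rw [SimpleGraph.connected_iff_exists_forall_reachable]
  refine ⟨M.cell 1 a₀, fun c => ?_⟩
  obtain ⟨a, rfl⟩ := M.exists_cell_eq c
  refine (R.iff_of_touchesBelow (P := fun a => R.dualGraph.Reachable (M.cell 1 a₀) (M.cell 1 a))
    (fun a => ?_) (fun a => ?_) (fun a ha _ => ?_) (R.touchesBelow_root a₀)
    (R.touchesBelow_root a)).mp (SimpleGraph.Reachable.refl _)
  · rw [M.cell_swap (by decide)]
  · rw [M.cell_swap (by decide)]
  · by_cases h : M.cell 1 a = M.cell 1 (M.swap 1 a)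
    · rw [← h]
    · have hadj : R.dualGraph.Adj (M.cell 1 a) (M.cell 1 (M.swap 1 a)) := ⟨h, a, ha, rfl, rfl⟩
      exact ⟨fun h => h.trans hadj.symm.reachable, fun h => h.trans hadj.reachable⟩

/-- Besides the flags at the edges of the tree and the flags crossed by a spanning tree of the dual
of its complement there are at most `2 g` flags, where `g` is the Euler genus. -/
theorem exists_dual_tree {g : ℕ} (hg : M.eulerGenus = g) :
    ∃ (T : SimpleGraph (M.Cell 1)) (X : Set Φ), T.IsTree ∧ X.ncard ≤ 2 * g ∧
      ∀ a, ¬ R.IsTreeFlag a → a ∉ X → T.Adj (M.cell 1 a) (M.cell 1 (M.swap 1 a)) := by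
  have := M.finite
  have := M.finite_cell 1
  obtain ⟨T, hTle, hT⟩ := R.dualGraph_connected.exists_isTree_le
  have hflag : ∀ e : T.edgeSet, ∃ a, ¬ R.IsTreeFlag a ∧
      s(M.cell 1 a, M.cell 1 (M.swap 1 a)) = (e : Sym2 (M.Cell 1)) := by
    rintro ⟨e, he⟩
    induction e using Sym2.ind with
    | _ x y =>
      obtain ⟨-, a, ha, rfl, rfl⟩ := hTle he
      exact ⟨a, ha, rfl⟩
  choose f hf hfe using hflag
  have hadj : ∀ e, T.Adj (M.cell 1 (f e)) (M.cell 1 (M.swap 1 (f e))) := by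
    intro e
    rw [← SimpleGraph.mem_edgeSet, hfe]
    exact e.2
  let S : Set Φ := {a | ∃ e, a = f e ∨ a = M.swap 1 (f e)}
  have hS : 2 * Nat.card T.edgeSet ≤ S.ncard := M.two_mul_card_le f (by
    rintro e e' (h | h)
    · refine Subtype.ext ?_
      rw [← hfe, ← hfe, h]
    · refine Subtype.ext ?_
      rw [← hfe, ← hfe, h, M.swap_swap, Sym2.eq_swap])
  have hdisj : Disjoint {a | R.IsTreeFlag a} S := by
    rw [Set.disjoint_left]
    rintro a ha ⟨e, rfl | rfl⟩
    · exact hf e ha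
    · exact hf e (R.isTreeFlag_swap_one.mp ha)
  have hcardT := (SimpleGraph.isTree_iff_connected_and_card.mp hT).2
  refine ⟨T, ({a | R.IsTreeFlag a} ∪ S)ᶜ, hT, ?_, ?_⟩
  -- Write `V`, `E`, `F` for the numbers of cells. Of at most `4E` flags, at least `2(V + F - 1)`
  -- belong to the radial tree and at least `2(E - 1)` to the dual tree, which leaves at most `2(2 -
  -- V + E - F) = 2g`.
  · have h1 := Set.ncard_add_ncard_compl ({a | R.IsTreeFlag a} ∪ S)
    rw [Set.ncard_union_eq hdisj] at h1
    have h2 := R.two_mul_card_nodes_le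
    have h3 := M.card_flags_le
    rw [eulerGenus, eulerChar] at hg
    omega
  · intro a ha haX
    rw [Set.mem_compl_iff, not_not] at haX
    obtain ⟨e, rfl | rfl⟩ := haX.resolve_left ha
    · exact hadj e
    · rw [M.swap_swap]
      exact (hadj e).symm

theorem depth_iterate_parent (n : ℕ) (z : M.RadialNode) :
    R.depth (R.parent^[n] z) = R.depth z - n := by
  induction n with
  | zero => rfl
  | succ n ih =>
    rw [Function.iterate_succ_apply']
    by_cases h : R.parent^[n] z = R.root
    · have h0 := (R.depth_eq_zero _).mpr h
      rw [h, R.parent_root, (R.depth_eq_zero _).mpr rfl]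
      omega
    · have := R.depth_parent _ h
      omega

/-- A node has at most one ancestor at a given depth. -/
theorem eq_iterate_parent {y z : M.RadialNode} (h : z ∈ descendants R.parent y) :
    y = R.parent^[R.depth z - R.depth y] z := by
  obtain ⟨n, rfl⟩ := h
  have hn := R.depth_iterate_parent n z
  by_cases hle : n ≤ R.depth z
  · rw [hn]
    congr 1
    omega
  · have h0 : R.depth (R.parent^[n] z) = 0 := by omega
    rw [h0, (R.depth_eq_zero _).mp h0, eq_comm, ← R.depth_eq_zero, R.depth_iterate_parent]
    omega

end RadialTree

theorem hasIntLayeredDecomposition_skeleton {g : ℕ} (hg : M.eulerGenus = g) :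
    HasIntLayeredDecomposition M.skeleton (8 * g + 16) := by
  classical
  have := M.finite
  have := Fintype.ofFinite Φ
  obtain ⟨R⟩ := M.nonempty_radialTree
  obtain ⟨T, X, hT, hX, hTX⟩ := R.exists_dual_tree hg
  let bag : M.Cell 1 → Set (M.Cell 0) := fun e =>
    {x | ∃ a, (M.cell 1 a = e ∨ a ∈ X) ∧ R.TouchesBelow a (Sum.inl x)}
  have hself : ∀ a, M.cell 0 a ∈ bag (M.cell 1 a) := fun a =>
    ⟨a, Or.inl rfl, _, self_mem_descendants _ _, Or.inl rfl⟩
  -- The ends of an edge of the surface share a face, so their depths differ by at most 2 and their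
  -- halved depths by at most 1.
  refine ⟨M.Cell 1, M.finite_cell 1, T, bag, fun x => ((R.depth (Sum.inl x) / 2 : ℕ) : ℤ), hT,
    ?_, ?_, ?_, ?_⟩
  · intro x
    by_cases hx : ∃ a ∈ X, R.TouchesBelow a (Sum.inl x)
    · obtain ⟨a, haX, hax⟩ := hx
      have huniv : {e | x ∈ bag e} = Set.univ :=
        Set.eq_univ_of_forall fun e => ⟨a, Or.inr haX, hax⟩
      rw [huniv]
      exact (SimpleGraph.induceUnivIso T).connected_iff.mpr hT.connected
    · have hmem : ∀ {e}, x ∈ bag e ↔ ∃ a, M.cell 1 a = e ∧ R.TouchesBelow a (Sum.inl x) := by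
        intro e
        refine ⟨?_, fun ⟨a, ha, hax⟩ => ⟨a, Or.inl ha, hax⟩⟩
        rintro ⟨a, ha | ha, hax⟩
        exacts [⟨a, ha, hax⟩, absurd ⟨a, ha, hax⟩ hx]
      obtain ⟨a₀, rfl⟩ := M.exists_cell_eq x
      rw [SimpleGraph.connected_iff_exists_forall_reachable]
      refine ⟨⟨M.cell 1 a₀, hself a₀⟩, ?_⟩
      rintro ⟨e, he⟩
      obtain ⟨a, rfl, ha⟩ := hmem.mp he
      let Q : M.Cell 1 → Prop := fun e => ∃ h : M.cell 0 a₀ ∈ bag e,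
        (T.induce {e | M.cell 0 a₀ ∈ bag e}).Reachable ⟨M.cell 1 a₀, hself a₀⟩ ⟨e, h⟩
      have hQ : Q (M.cell 1 a) := by
        refine (R.iff_of_touchesBelow (P := fun a => Q (M.cell 1 a)) (z := Sum.inl (M.cell 0 a₀))
          (fun a => by rw [M.cell_swap (by decide)]) (fun a => by rw [M.cell_swap (by decide)])
          (fun b hb hbz => ?_) ⟨_, self_mem_descendants _ _, Or.inl rfl⟩ ha).mp
          ⟨hself a₀, SimpleGraph.Reachable.refl _⟩
        have hadj := hTX b hb fun hbX => hx ⟨b, hbX, hbz⟩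
        have h₁ : M.cell 0 a₀ ∈ bag (M.cell 1 b) := hmem.mpr ⟨b, rfl, hbz⟩
        have h₂ : M.cell 0 a₀ ∈ bag (M.cell 1 (M.swap 1 b)) :=
          hmem.mpr ⟨_, rfl, R.touchesBelow_swap_one.mpr hbz⟩
        have hadj' : (T.induce {e | M.cell 0 a₀ ∈ bag e}).Adj ⟨_, h₁⟩ ⟨_, h₂⟩ := hadj
        exact ⟨fun ⟨_, h⟩ => ⟨h₁, h.trans hadj'.symm.reachable⟩,
          fun ⟨_, h⟩ => ⟨h₂, h.trans hadj'.reachable⟩⟩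
      exact hQ.2
  · rintro x y ⟨-, a, rfl, rfl⟩
    refine ⟨M.cell 1 a, hself a, ?_⟩
    have := hself (M.swap 0 a)
    rwa [M.cell_swap (k := 1) (by decide)] at this
  · rintro x y ⟨-, a, rfl, rfl⟩
    have hface : M.Touches (M.swap 0 a) (Sum.inr (M.cell 2 a)) :=
      Or.inr (by rw [M.cell_swap (by decide)])
    have h1 := R.depth_le a (Sum.inl (M.cell 0 a)) (Sum.inr (M.cell 2 a)) (Or.inl rfl) (Or.inr rfl)
    have h2 := R.depth_le a (Sum.inr (M.cell 2 a)) (Sum.inl (M.cell 0 a)) (Or.inr rfl) (Or.inl rfl)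
    have h3 := R.depth_le (M.swap 0 a) (Sum.inl (M.cell 0 (M.swap 0 a))) (Sum.inr (M.cell 2 a))
      (Or.inl rfl) hface
    have h4 := R.depth_le (M.swap 0 a) (Sum.inr (M.cell 2 a)) (Sum.inl (M.cell 0 (M.swap 0 a)))
      hface (Or.inl rfl)
    change |((R.depth (Sum.inl (M.cell 0 a)) / 2 : ℕ) : ℤ) -
      ((R.depth (Sum.inl (M.cell 0 (M.swap 0 a))) / 2 : ℕ) : ℤ)| ≤ 1
    rw [abs_le]
    omega
  · intro e i
    let A : Finset Φ := (Finset.univ.filter fun a => M.cell 1 a = e) ∪ X.toFinset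
    -- At most four flags at `e` and `2 * g` exceptional ones. Each has two corners, and each corner
    -- contributes one ancestor at each of the two depths forming a layer, hence the factor 4 below.
    have hA : A.card ≤ 4 + 2 * g := by
      refine (Finset.card_union_le _ _).trans (Nat.add_le_add (M.card_cell_one_fiber_le e) ?_)
      rwa [← Set.ncard_eq_toFinset_card']
    let anc : M.RadialNode → ℕ → M.RadialNode := fun z m => R.parent^[R.depth z - m] z
    let C : Finset M.RadialNode := A.biUnion fun a =>
      {anc (Sum.inl (M.cell 0 a)) (2 * i.toNat), anc (Sum.inl (M.cell 0 a)) (2 * i.toNat + 1),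
        anc (Sum.inr (M.cell 2 a)) (2 * i.toNat), anc (Sum.inr (M.cell 2 a)) (2 * i.toNat + 1)}
    have hC : C.card ≤ 8 * g + 16 := by
      have h := Finset.card_biUnion_le_card_mul A (fun a =>
        ({anc (Sum.inl (M.cell 0 a)) (2 * i.toNat), anc (Sum.inl (M.cell 0 a)) (2 * i.toNat + 1),
        anc (Sum.inr (M.cell 2 a)) (2 * i.toNat),
        anc (Sum.inr (M.cell 2 a)) (2 * i.toNat + 1)} : Finset M.RadialNode)) 4
        fun a _ => Finset.card_le_four
      have h' : C.card ≤ A.card * 4 := h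
      omega
    have hsub : Sum.inl '' (bag e ∩ {x | ((R.depth (Sum.inl x) / 2 : ℕ) : ℤ) = i}) ⊆
        (C : Set M.RadialNode) := by
      rintro _ ⟨x, ⟨⟨a, ha, z, hz, haz⟩, hxi⟩, rfl⟩
      change ((R.depth (Sum.inl x) / 2 : ℕ) : ℤ) = i at hxi
      have hx := R.eq_iterate_parent hz
      have hd : R.depth (Sum.inl x) = 2 * i.toNat ∨ R.depth (Sum.inl x) = 2 * i.toNat + 1 := by
        omega
      have hanc : Sum.inl x = anc z (2 * i.toNat) ∨ Sum.inl x = anc z (2 * i.toNat + 1) := by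
        rcases hd with hd | hd
        · exact Or.inl (by rw [hd] at hx; exact hx)
        · exact Or.inr (by rw [hd] at hx; exact hx)
      simp only [C, Finset.coe_biUnion, Set.mem_iUnion, Finset.mem_coe, Finset.mem_insert,
        Finset.mem_singleton, exists_prop]
      refine ⟨a, by simpa [A] using ha, ?_⟩
      rcases haz with rfl | rfl
      · tauto
      · tauto
    calc _ = (Sum.inl '' (bag e ∩ {x | ((R.depth (Sum.inl x) / 2 : ℕ) : ℤ) = i}) :
          Set M.RadialNode).encard := (Sum.inl_injective.encard_image _).symm
      _ ≤ (C : Set M.RadialNode).encard := Set.encard_le_encard hsub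
      _ = C.card := Set.encard_coe_eq_coe_finsetCard C
      _ ≤ _ := by exact_mod_cast hC

end CellularSurface

/-- Pulling bags back to a subgraph may empty some of them, which is why nonempty bags are not part
of `HasIntLayeredDecomposition`. -/
theorem HasIntLayeredDecomposition.of_isContained {V : Type u} {V' : Type} {G : SimpleGraph V}
    {H : SimpleGraph V'} {w : ℕ} (hH : HasIntLayeredDecomposition H w) (h : G.IsContained H) :
    HasIntLayeredDecomposition G w := by
  obtain ⟨ι, hι, T, bag, idx, hT, hconn, hedge, hidx, hbag⟩ := hH
  obtain ⟨f⟩ := h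
  refine ⟨ι, hι, T, fun x => f.toHom ⁻¹' bag x, fun v => idx (f.toHom v), hT,
    fun v => hconn (f.toHom v), fun u v huv => hedge _ _ (f.toHom.map_adj huv),
    fun u v huv => hidx _ _ (f.toHom.map_adj huv), fun x i => ?_⟩
  rw [← f.injective'.encard_image]
  refine (Set.encard_le_encard ?_).trans (hbag x i)
  rintro _ ⟨v, ⟨hv, hvi⟩, rfl⟩
  exact ⟨hv, hvi⟩

theorem hasIntLayeredDecomposition_of_graphEulerGenus_le {V : Type u} {G : SimpleGraph V} {g : ℕ}
    (h : graphEulerGenus G ≤ g) : HasIntLayeredDecomposition G (8 * g + 16) := by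
  obtain ⟨n, hn, Φ, M, hM, hG⟩ : ∃ n ≤ g, EmbedsInEulerGenus G n := by
    by_contra hcon
    push Not at hcon
    have hle : ((g + 1 : ℕ) : ℕ∞) ≤ graphEulerGenus G := by
      refine le_iInf₂ fun n hn => ?_
      have : g + 1 ≤ n := by
        by_contra hlt
        exact hcon n (by omega) hn
      exact_mod_cast this
    have := hle.trans h
    have : g + 1 ≤ g := by exact_mod_cast this
    omega
  obtain ⟨ι, hι, T, bag, idx, hT, hconn, hedge, hidx, hbag⟩ :=
    (M.hasIntLayeredDecomposition_skeleton hM).of_isContained hG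
  refine ⟨ι, hι, T, bag, idx, hT, hconn, hedge, hidx, fun x i => (hbag x i).trans ?_⟩
  exact_mod_cast (by omega : 8 * n + 16 ≤ 8 * g + 16)

/-! ### Conclusion of both bounds. -/

theorem ColorableWithClustering.mono {V : Type u} {G : SimpleGraph V} {k η η' : ℕ}
    (h : ColorableWithClustering G k η) (hη : η ≤ η') : ColorableWithClustering G k η' := by
  obtain ⟨c, hc⟩ := h
  exact ⟨c, fun i K => (hc i K).trans (by exact_mod_cast hη)⟩

theorem theorem2 :
    (∃ C : ℕ, ∀ w Δ : ℕ, 1 ≤ w → 1 ≤ Δ →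
      ∀ (V : Type u) [Fintype V] (G : SimpleGraph V) [DecidableRel G.Adj],
        layeredTreewidth G ≤ w → G.maxDegree ≤ Δ →
          ColorableWithClustering G 3 (C * w ^ 19 * Δ ^ 37)) ∧
    (∃ C : ℕ, ∀ g Δ : ℕ, 1 ≤ g → 1 ≤ Δ →
      ∀ (V : Type u) [Fintype V] (G : SimpleGraph V) [DecidableRel G.Adj],
        graphEulerGenus G ≤ g → G.maxDegree ≤ Δ →
          ColorableWithClustering G 3 (C * g ^ 19 * Δ ^ 37)) := by
  refine ⟨⟨336 * 168 ^ 9, ?_⟩, ⟨336 * 168 ^ 9 * 24 ^ 10, ?_⟩⟩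
  · intro w Δ hw hΔ V _ G _ hG hdeg
    -- Without vertices no bag is nonempty, so no decomposition exists and the layered treewidth is
    -- the default value 0 of an empty infimum.
    rcases isEmpty_or_nonempty V with hV | hV
    · exact ⟨fun _ => 0, hasClustering_of_closed fun v => (hV.false v).elim⟩
    · refine ((hasIntLayeredDecomposition_of_layeredTreewidth_le hG).colorableWithClustering hw hΔ
        hdeg).mono ?_
      exact Nat.mul_le_mul (Nat.mul_le_mul_left _ (Nat.pow_le_pow_right hw (by norm_num)))
        (Nat.pow_le_pow_right hΔ (by norm_num))
  · intro g Δ hg hΔ V _ G _ hG hdeg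
    refine ((hasIntLayeredDecomposition_of_graphEulerGenus_le hG).colorableWithClustering (by omega)
      hΔ hdeg).mono ?_
    refine Nat.mul_le_mul ?_ (Nat.pow_le_pow_right hΔ (by norm_num))
    -- The constant 24 comes from `8 * g + 16 ≤ 24 * g`, which holds as `g` is positive.
    calc 336 * 168 ^ 9 * (8 * g + 16) ^ 10 ≤ 336 * 168 ^ 9 * (24 * g) ^ 10 :=
          Nat.mul_le_mul_left _ (Nat.pow_le_pow_left (by omega) 10)
      _ = 336 * 168 ^ 9 * 24 ^ 10 * g ^ 10 := by
          rw [mul_pow, ← mul_assoc]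
      _ ≤ 336 * 168 ^ 9 * 24 ^ 10 * g ^ 19 :=
          Nat.mul_le_mul_left _ (Nat.pow_le_pow_right hg (by norm_num))
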